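/- Let $\mathbb{F}_q$ be a finite field, let $F$ be the function field of a nonsingular projective curve over $\mathbb{F}_q$, let $\infty$ be a closed point of the curve, and let $A\subset F$ be the ring of functions that are regular everywhere except possibly at $\infty$ (so $\mathrm{Frac}(A)=F$). Let $K$ be a finitely generated field extension of $\mathbb{F}_q$, realized as the function field of a normal projective variety $V\subset\mathbb{P}^M$ defined over a finite extension of $\mathbb{F}_q$ in $K$. Let $K\{\tau\}$ be the ring of polynomials in $\tau$ over $K$ with $\tau c=c^q\tau$ for $c \in K$; such a polynomial $\sum a_i\tau^i$ acts on $K^{\mathrm{alg}}$ by $x\mapsto\sum a_ix^{q^i}$, and its degree is its degree as a polynomial in $x$. Let $i:A\to K$ be a ring homomorphism and $\phi:A\to K\{\tau\}$ a Drinfeld module, i.e. a ring homomorphism such that for each $a\in A$ the coefficient of $\tau^0$ in $\phi_a$ is $i(a)$. Assume that $\phi$ has generic characteristic, i.e. that $i$ is injective. For a finite extension $L/K$ let $M_L$ be the set of discrete valuations of $L$, normalized to have value group $\mathbb{Z}$, attached to the prime divisors of the normalization of $V$ in $L$. For $x\in L$ and $v\in M_L$ lying above $v_0\in M_K$, with ramification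 index $e(v|v_0)$ and residue degree $f(v|v_0)$, define the local height $$\hat h_v(x)=-\frac{\deg(v_0)\,f(v|v_0)}{[L:K]}\;\lim_{n\to\infty}\frac{\min\{0,v(\phi_{t^n}(x))\}}{\deg\phi_{t^n}},$$ where $t\in A$ is non-constant (transcendental over $\mathbb{F}_q$) and $\deg(v_0)$ is the projective degree in $\mathbb{P}^M$ of the prime divisor of $V$ attached to $v_0$. Then there are constants $C>0$ and $k>0$, depending only on $\phi$ (and on the fixed data $A$, $K$, $V\subset\mathbb{P}^M$), with the following property. For every non-constant $t\in A$, every $x\in K^{\mathrm{alg}}$, and every $v\in M_{K(x)}$ whose restriction to $\mathrm{Frac}(A)$ is not the place $\infty$, with $v_0\in M_K$ the place below $v$: if the local height $\hat h_v(x)$ computed with $t$ is positive, then $$\hat h_v(x)\ \ge\ \frac{C}{e(v|v_0)^{k-1}\,[K(x):K]}.$$ -/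

import Mathlib

open IntermediateField
open scoped WithZero Polynomial

noncomputable section

namespace LocalLehmer

/-! ### The ring `A` -/

/-- Let `F` be the function field of a nonsingular projective curve over a finite field. The closed
points of the curve correspond to the valuation subrings `O ≠ ⊤` of `F`. Given such a closed point
`infty`, this is the ring `A` of those functions that are regular at every closed point except
possibly at `infty`. -/
def regularAway {F : Type*} [Field F] (infty : ValuationSubring F) : Subring F :=
  ⨅ O : {O : ValuationSubring F // O ≠ ⊤ ∧ O ≠ infty}, O.1.toSubring

/-- The place `v` of `L` lies over the place `infty` of `Frac(A) = F`: the valuation ring of `v`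
meets `Frac(A)` (embedded in `L` through the injective map `i : A → L`) exactly in the valuation
ring of `infty`. -/
def LiesOverInfinity {F L : Type*} [Field F] [Field L] (infty : ValuationSubring F)
    (i : regularAway infty →+* L) (v : Valuation L ℤᵐ⁰) : Prop :=
  ∀ a b : regularAway infty, b ≠ 0 → ((a : F) / (b : F) ∈ infty ↔ v (i a / i b) ≤ 1)

/-! ### Twisted polynomials and Drinfeld modules -/

/-- `τ ^ n` acts on `K` by `x ↦ x ^ (q ^ n)`, where `q` is the cardinality of `Fq`. -/
abbrev frobeniusAction (Fq K : Type*) [Field Fq] [Fintype Fq] [Field K] [Algebra Fq K] :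
    MulSemiringAction (Multiplicative ℕ) K where
  smul n x := (FiniteField.frobeniusAlgHom Fq K ^ n.toAdd) x
  one_smul x := by
    change (FiniteField.frobeniusAlgHom Fq K ^ 0) x = x
    simp
  mul_smul m n x := by
    change (FiniteField.frobeniusAlgHom Fq K ^ (m.toAdd + n.toAdd)) x =
      (FiniteField.frobeniusAlgHom Fq K ^ m.toAdd) ((FiniteField.frobeniusAlgHom Fq K ^ n.toAdd) x)
    rw [pow_add]
    rfl
  smul_zero n := map_zero (FiniteField.frobeniusAlgHom Fq K ^ n.toAdd)
  smul_add n := map_add (FiniteField.frobeniusAlgHom Fq K ^ n.toAdd)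
  smul_one n := map_one (FiniteField.frobeniusAlgHom Fq K ^ n.toAdd)
  smul_mul n := map_mul (FiniteField.frobeniusAlgHom Fq K ^ n.toAdd)

/-- The ring `K{τ}`, with `τ c = c ^ q τ` for `c ∈ K`. -/
def TwistedPoly (Fq K : Type*) [Field Fq] [Fintype Fq] [Field K] [Algebra Fq K] : Type _ :=
  SkewPolynomial K

namespace TwistedPoly

variable {Fq K : Type*} [Field Fq] [Fintype Fq] [Field K] [Algebra Fq K]

instance : Ring (TwistedPoly Fq K) :=
  letI := frobeniusAction Fq K
  inferInstanceAs (Ring (SkewPolynomial K))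

/-- The coefficient of `τ ^ n`. -/
def coeff (p : TwistedPoly Fq K) (n : ℕ) : K := SkewPolynomial.coeff p n

/-- The finite set of exponents of `τ` with nonzero coefficient. -/
def support (p : TwistedPoly Fq K) : Finset ℕ := SkewPolynomial.support p

/-- The value of the operator `∑ aᵢ τ ^ i` at `x`, that is, `∑ aᵢ x ^ (q ^ i)`. -/
def eval {L : Type*} [Field L] [Algebra K L] (p : TwistedPoly Fq K) (x : L) : L :=
  ∑ i ∈ p.support, algebraMap K L (p.coeff i) * x ^ (Fintype.card Fq ^ i)

/-- The degree of `∑ aᵢ x ^ (q ^ i)` as a polynomial in `x`, that is, `q ^ r` with `r` the degree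
in `τ`. -/
def deg (p : TwistedPoly Fq K) : ℕ := Fintype.card Fq ^ p.support.sup id

end TwistedPoly

/-- A Drinfeld module over `i : A → K`. -/
structure DrinfeldModule (Fq A K : Type*) [Field Fq] [Fintype Fq] [CommRing A] [Field K]
    [Algebra Fq K] where
  /-- The structure morphism `i : A → K`. -/
  i : A →+* K
  /-- The morphism `a ↦ φ_a`. -/
  toHom : A →+* TwistedPoly Fq K
  coeff_zero : ∀ a, (toHom a).coeff 0 = i a

/-- `φ` has generic characteristic if `ker i = 0`. -/
def DrinfeldModule.IsGeneric {Fq A K : Type*} [Field Fq] [Fintype Fq] [CommRing A] [Field K]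
    [Algebra Fq K] (φ : DrinfeldModule Fq A K) : Prop :=
  RingHom.ker φ.i = ⊥

/-! ### Projective models and their divisors -/

/-- A normal projective variety `V`, over a finite extension `k` of `Fq`, embedded in the projective
space `ℙ^M` over `k`, with function field `K`. It is given by homogeneous coordinates, in its
function field `K`, of its generic point. -/
structure ProjectiveModel (Fq K : Type*) [Field Fq] [Field K] [Algebra Fq K] where
  /-- The finite field of definition. -/
  k : IntermediateField Fq K
  [finite_k : Finite k]
  /-- The dimension of the ambient projective space. -/
  M : ℕ
  /-- The homogeneous coordinates of the generic point of `V`. -/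
  coord : Fin (M + 1) → K
  coord_ne_zero : coord ≠ 0
  /-- The function field of `V` is `K`. -/
  adjoin_eq_top : ∀ j, coord j ≠ 0 →
    IntermediateField.adjoin k (Set.range fun l ↦ coord l / coord j) = ⊤
  /-- `V` is normal. -/
  normal : ∀ j, coord j ≠ 0 →
    IsIntegrallyClosed (Algebra.adjoin k (Set.range fun l ↦ coord l / coord j))

/-- A valuation is trivial on a finite field. -/
theorem map_le_one_of_finite {K : Type*} [Field K] (v : Valuation K ℤᵐ⁰) {R : Type*}
    [Field R] [Finite R] [Algebra R K] (c : R) : v (algebraMap R K c) ≤ 1 := by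
  rcases eq_or_ne c 0 with rfl | hc
  · simp
  · obtain ⟨n, hn, h⟩ := (isOfFinOrder_of_finite (Units.mk0 c hc)).exists_pow_eq_one
    have hc' : c ^ n = 1 := by simpa using congrArg Units.val h
    have h1 : v (algebraMap R K c) ^ n = 1 := by rw [← map_pow, ← map_pow, hc']; simp
    by_contra! hlt
    exact (one_lt_pow₀ hlt hn.ne').ne' h1

section Hilbert

variable {k K : Type*} [Field k] [Finite k] [Field K] [Algebra k K] {M : ℕ} (c : Fin (M + 1) → K)
  (v : Valuation K ℤᵐ⁰)

/-- Let `c` be the homogeneous coordinates of a point of `ℙ^M` in `K`, and let `Z` be the closed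
subvariety of `ℙ^M` over `k` whose generic point is the reduction of this point modulo the maximal
ideal of `v` (divide the coordinates by one of maximal size and reduce). These are the homogeneous
polynomials of degree `n` that vanish on `Z`. -/
def vanishing (n : ℕ) : Submodule k (MvPolynomial.homogeneousSubmodule (Fin (M + 1)) k n) where
  carrier := {F | ∀ j, (∀ l, v (c l) ≤ v (c j)) →
    v (MvPolynomial.aeval (fun l ↦ c l / c j) (F : MvPolynomial (Fin (M + 1)) k)) < 1}
  zero_mem' := by
    intro j _
    simp
  add_mem' := by
    intro F G hF hG j hj
    rw [Submodule.coe_add, map_add]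
    exact v.map_add_lt (hF j hj) (hG j hj)
  smul_mem' := by
    intro a F hF j hj
    rw [Submodule.coe_smul, map_smul, Algebra.smul_def, map_mul]
    exact mul_lt_one_of_nonneg_of_lt_one_right (map_le_one_of_finite v a) zero_le (hF j hj)

variable (k) in
/-- The Hilbert function of `Z`: the dimension of the degree `n` part of its homogeneous coordinate
ring. -/
def hilbertFunction (n : ℕ) : ℕ :=
  Module.finrank k (MvPolynomial.homogeneousSubmodule (Fin (M + 1)) k n ⧸ vanishing (k := k) c v n)

end Hilbert

attribute [instance] ProjectiveModel.finite_k

namespace ProjectiveModel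

variable {Fq K : Type*} [Field Fq] [Field K] [Algebra Fq K] (V : ProjectiveModel Fq K)

/-- The ring of regular functions on the affine chart of `V` where the `j`-th homogeneous
coordinate does not vanish. -/
def chart (j : Fin (V.M + 1)) : Subalgebra V.k K :=
  Algebra.adjoin V.k (Set.range fun l ↦ V.coord l / V.coord j)

/-- The set `M_L` of the normalized valuations (written multiplicatively, with value group exactly
`ℤ`) that belong to the prime divisors of the normalization `W` of `V` in `L`: the affine charts of
`W` are the spectra of the integral closures in `L` of the affine charts of `V`, and the valuation
ring is the local ring of such a chart at a prime ideal `P` of height one. -/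
def divisors (L : Type*) [Field L] [Algebra K L] : Set (Valuation L ℤᵐ⁰) :=
  {v | Function.Surjective v ∧ ∃ j, V.coord j ≠ 0 ∧
    ∃ P : Ideal (integralClosure (V.chart j) L), P.IsPrime ∧ P.height = 1 ∧
      ∀ y : L, v y ≤ 1 ↔ ∃ a b : integralClosure (V.chart j) L, b ∉ P ∧ y = (a : L) / (b : L)}

open Classical in
/-- The projective degree of the divisor of `v ∈ M_K` in `ℙ^M`: `D! c`, where `D` is the degree and `c`
the leading coefficient of its Hilbert polynomial. -/
def degree (v : Valuation K ℤᵐ⁰) : ℚ :=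
  if h : ∃ p : ℚ[X], ∀ᶠ n : ℕ in Filter.atTop,
      (hilbertFunction V.k V.coord v n : ℚ) = p.eval (n : ℚ) then
    (h.choose.natDegree.factorial : ℚ) * h.choose.leadingCoeff
  else 0

end ProjectiveModel

/-! ### Local heights -/

/-- `ṽ(x) = min {0, v(x)}`, with `v` written additively (so `v(0) = +∞` gives `ṽ(0) = 0`). -/
def truncOrd {L : Type*} [Field L] (v : Valuation L ℤᵐ⁰) (x : L) : ℤ :=
  min 0 (-WithZero.log (v x))

section Extension

variable {K L : Type*} [Field K] [Field L] [Algebra K L]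
  (v₀ : Valuation K ℤᵐ⁰) (v : Valuation L ℤᵐ⁰)

/-- The ramification index: the `e` with `v|_K = e v₀` (in additive notation). -/
def ramificationIndex : ℕ := sInf {e : ℕ | ∀ y : K, v (algebraMap K L y) = v₀ y ^ e}

/-- The residue degree `f(v|v₀)` of a place `v` above `v₀`. -/
def residueDegree [v₀.HasExtension v] : ℕ :=
  Module.finrank (IsLocalRing.ResidueField v₀.valuationSubring)
    (IsLocalRing.ResidueField v.valuationSubring)

end Extension

/-- `V_v(x) = lim ṽ(φ_{a^n}(x)) / deg(φ_{a^n})`. -/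
def limitHeight {Fq A K L : Type*} [Field Fq] [Fintype Fq] [CommRing A] [Field K] [Algebra Fq K]
    [Field L] [Algebra K L] (φ : DrinfeldModule Fq A K) (a : A) (v : Valuation L ℤᵐ⁰) (x : L) : ℝ :=
  Filter.limUnder Filter.atTop fun n : ℕ ↦
    (truncOrd v ((φ.toHom (a ^ n)).eval x) : ℝ) / ((φ.toHom (a ^ n)).deg : ℝ)

/-- The local height `-deg(v₀) f(v|v₀) / [L:K] * V_v(x)` of `x ∈ L` at a place `v` of `L` above the
place `v₀` of `K`, computed with the nonconstant element `a`. -/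
def localHeight {Fq A K L : Type*} [Field Fq] [Fintype Fq] [CommRing A] [Field K] [Algebra Fq K]
    [Field L] [Algebra K L] (V : ProjectiveModel Fq K) (φ : DrinfeldModule Fq A K) (a : A)
    (v₀ : Valuation K ℤᵐ⁰) (v : Valuation L ℤᵐ⁰) [v₀.HasExtension v] (x : L) : ℝ :=
  -(((V.degree v₀ : ℚ) : ℝ) * (residueDegree v₀ v : ℝ) / (Module.finrank K L : ℝ)) * limitHeight φ a v x

end LocalLehmer

end

open LocalLehmer

/-! Write q for the cardinality of `Fq`. Fix `t₀` such that p = φ_{t₀} has degree r > 0 in τ, and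
put D = q^r. The limit in the local height is, up to sign, an escape rate H(y) = lim log⁺|pⁿ(y)| /
Dⁿ. Since the φ_t commute, it does not depend on t (`escapeRate_eq_of_commute`). Tate's telescoping
argument gives |H − log⁺| ≤ 4Λ, where Λ bounds the logarithmic size of the nonzero coefficients of p
(`CoeffBound.escapeRate_spec`), and p multiplies H by D. So when H(y) > 0 it suffices to find m =
O(log Λ) with log⁺|p^m(y)| ≥ 6Λ: then D^m H(y) ≥ 2Λ, while D^m is polynomial in Λ.

Away from ∞ the linear coefficient of p is integral, so orbits stay bounded in the disc where no
higher term expands. Nontrivial `Fq`-combinations of y, p(y), …, p^{rn}(y) escape, hence lie outside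
this disc and have absolute value at least some |π| at which a term a z^{q^i} already expands. An
element u with |p(u)| < |a π^{q^i}| is closer than |π| to a root of p. Elements of the span are at
least |π| apart and p has at most q^r roots, so a subspace of such u has dimension at most r
(`finrank_le_tauDeg`). Discarding r dimensions in each of n steps leaves an element of the span
whose logarithmic size grows like q^n (`exists_le_iterate_eval`, `exists_iterate_large`). Thus m ≤
(r+1)n with q^n of order DΛ, and `le_escapeRate` follows with exponent k = r(r+1).

Over K(x) one takes Λ = eB, with e the ramification index and B uniform over the divisors of V,
because a nonzero function has finitely many zeros and poles. The remaining factors of a positive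
local height are positive integers, apart from 1/[K(x):K]. If every nonconstant φ_t has degree 0 in
τ, the limit is an integer up to sign, and positivity alone is enough. -/

noncomputable section

/-! ### Twisted polynomials as additive operators and as ordinary polynomials -/

namespace LocalLehmer
namespace TwistedPoly
open Polynomial

variable {Fq K : Type*} [Field Fq] [Fintype Fq] [Field K] [Algebra Fq K]
variable {L : Type*} [Field L] [Algebra K L]

/-- The degree in `τ`. -/
def tauDeg (p : TwistedPoly Fq K) : ℕ := p.support.sup id

theorem deg_eq (p : TwistedPoly Fq K) : p.deg = Fintype.card Fq ^ p.tauDeg := rfl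

theorem mem_support {p : TwistedPoly Fq K} {n : ℕ} : n ∈ p.support ↔ p.coeff n ≠ 0 :=
  SkewPolynomial.mem_support_iff

theorem le_tauDeg {p : TwistedPoly Fq K} {n : ℕ} (h : p.coeff n ≠ 0) : n ≤ p.tauDeg :=
  Finset.le_sup (f := id) (mem_support.2 h)

theorem support_nonempty {p : TwistedPoly Fq K} (hp : p ≠ 0) : p.support.Nonempty := by
  rw [Finset.nonempty_iff_ne_empty]
  exact fun h ↦ hp (SkewPolynomial.support_eq_empty.1 h)

theorem coeff_tauDeg_ne_zero {p : TwistedPoly Fq K} (hp : p ≠ 0) : p.coeff p.tauDeg ≠ 0 := by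
  obtain ⟨i, hi, h⟩ := Finset.exists_mem_eq_sup p.support (support_nonempty hp) id
  rw [tauDeg, h]
  exact mem_support.1 hi

theorem eval_eq_sum (p : TwistedPoly Fq K) (x : L) :
    p.eval x = SkewPolynomial.sum p fun n a ↦ algebraMap K L a * x ^ (Fintype.card Fq ^ n) :=
  (SkewPolynomial.sum_def p fun n a ↦ algebraMap K L a * x ^ (Fintype.card Fq ^ n)).symm

theorem eval_add_left (p s : TwistedPoly Fq K) (x : L) : (p + s).eval x = p.eval x + s.eval x := by
  simp only [eval_eq_sum]
  exact SkewMonoidAlgebra.sum_add_index' (by simp) (by simp [add_mul])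

/-- The monomial `a τ ^ n`. -/
def mono (n : ℕ) (a : K) : TwistedPoly Fq K := SkewPolynomial.monomial n a

theorem eval_mono (n : ℕ) (a : K) (x : L) :
    (mono n a : TwistedPoly Fq K).eval x = algebraMap K L a * x ^ (Fintype.card Fq ^ n) := by
  rw [eval_eq_sum]
  exact SkewPolynomial.sum_monomial_index (by simp)

theorem eval_one (x : L) : (1 : TwistedPoly Fq K).eval x = x := by
  have : (1 : TwistedPoly Fq K) = mono 0 1 := rfl
  rw [this, eval_mono]
  simp

theorem mono_mul_mono (n m : ℕ) (a b : K) :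
    (mono n a * mono m b : TwistedPoly Fq K) =
      mono (n + m) (a * b ^ (Fintype.card Fq ^ n)) := by
  let := frobeniusAction Fq K
  refine (SkewPolynomial.monomial_mul_monomial n m a b).trans ?_
  rw [SkewPolynomial.φ_iterate_apply]
  have : (Multiplicative.ofAdd n • b : K) = b ^ (Fintype.card Fq ^ n) := by
    change (FiniteField.frobeniusAlgHom Fq K ^ n) b = _
    induction n with
    | zero => simp
    | succ n ih => rw [pow_succ', AlgHom.mul_apply, ih, FiniteField.frobeniusAlgHom_apply,
        ← pow_mul, pow_succ]
  rw [this]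
  rfl

theorem induction_mono {P : TwistedPoly Fq K → Prop} (p : TwistedPoly Fq K) (h0 : P 0)
    (hadd : ∀ n a s, P s → P (mono n a + s)) : P p :=
  SkewPolynomial.induction p h0 fun n a s _ _ hs ↦ hadd n a s hs

theorem eval_zero_left (x : L) : (0 : TwistedPoly Fq K).eval x = 0 := by
  rw [eval_eq_sum]; exact SkewMonoidAlgebra.sum_zero_index

theorem add_pow_card_pow [Algebra Fq L] (n : ℕ) (x y : L) :
    (x + y) ^ (Fintype.card Fq ^ n) = x ^ (Fintype.card Fq ^ n) + y ^ (Fintype.card Fq ^ n) := by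
  induction n with
  | zero => simp
  | succ n ih =>
    simp only [pow_succ, pow_mul, ih]
    simpa using map_add (FiniteField.frobeniusAlgHom Fq L) (x ^ (Fintype.card Fq ^ n))
      (y ^ (Fintype.card Fq ^ n))

theorem card_pow_ne_zero (n : ℕ) : Fintype.card Fq ^ n ≠ 0 := pow_ne_zero _ Fintype.card_ne_zero

section

variable [Algebra Fq L]

theorem eval_add (p : TwistedPoly Fq K) (x y : L) : p.eval (x + y) = p.eval x + p.eval y := by
  simp [eval, add_pow_card_pow, mul_add, Finset.sum_add_distrib]

theorem eval_smul (p : TwistedPoly Fq K) (c : Fq) (x : L) : p.eval (c • x) = c • p.eval x := by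
  simp only [eval, Finset.smul_sum]
  refine Finset.sum_congr rfl fun i _ ↦ ?_
  rw [_root_.smul_pow, FiniteField.pow_card_pow, mul_smul_comm]

/-- The `Fq`-linear operator of `p` on `L`. -/
def evalLin (L : Type*) [Field L] [Algebra K L] [Algebra Fq L] (p : TwistedPoly Fq K) :
    L →ₗ[Fq] L where
  toFun := p.eval
  map_add' := p.eval_add
  map_smul' := p.eval_smul

@[simp]
theorem evalLin_apply (p : TwistedPoly Fq K) (x : L) : p.evalLin L x = p.eval x := rfl

theorem eval_zero (p : TwistedPoly Fq K) : p.eval (0 : L) = 0 := map_zero (p.evalLin L)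

theorem eval_mul (p s : TwistedPoly Fq K) (x : L) : (p * s).eval x = p.eval (s.eval x) := by
  induction p using induction_mono with
  | h0 => rw [zero_mul, eval_zero_left, eval_zero_left]
  | hadd n a p hp =>
    rw [add_mul, eval_add_left, eval_add_left, hp]
    congr 1
    clear hp p
    induction s using induction_mono with
    | h0 => rw [mul_zero, eval_zero_left, eval_zero]
    | hadd m b s hs =>
      rw [mul_add, eval_add_left, eval_add_left, hs, eval_add, mono_mul_mono]
      congr 1
      simp only [eval_mono, map_mul, map_pow, mul_pow, ← pow_mul, pow_add]
      rw [mul_comm (Fintype.card Fq ^ n) (Fintype.card Fq ^ m)]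
      ring

theorem eval_pow (p : TwistedPoly Fq K) (n : ℕ) (x : L) : (p ^ n).eval x = p.eval^[n] x := by
  induction n generalizing x with
  | zero => simp [eval_one]
  | succ n ih => rw [pow_succ, eval_mul, ih, Function.iterate_succ_apply]

end

/-- The polynomial `∑ aᵢ X ^ (q ^ i)`. -/
def toPoly (p : TwistedPoly Fq K) : K[X] :=
  ∑ i ∈ p.support, C (p.coeff i) * X ^ (Fintype.card Fq ^ i)

theorem aeval_toPoly (p : TwistedPoly Fq K) (x : L) : aeval x p.toPoly = p.eval x := by
  simp [toPoly, eval]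

theorem coeff_toPoly (p : TwistedPoly Fq K) (i : ℕ) :
    p.toPoly.coeff (Fintype.card Fq ^ i) = p.coeff i := by
  have h : ∀ j, Fintype.card Fq ^ i = Fintype.card Fq ^ j ↔ i = j := fun j ↦
    (Nat.pow_right_injective Fintype.one_lt_card).eq_iff
  simp only [toPoly, finsetSum_coeff, coeff_C_mul, coeff_X_pow, h]
  simp [mem_support, eq_comm]

theorem natDegree_toPoly_le (p : TwistedPoly Fq K) : p.toPoly.natDegree ≤ p.deg := by
  refine natDegree_sum_le_of_forall_le _ _ fun i hi ↦ (natDegree_C_mul_X_pow_le _ _).trans ?_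
  exact Nat.pow_le_pow_right Fintype.card_pos (Finset.le_sup (f := id) hi)

theorem natDegree_toPoly {p : TwistedPoly Fq K} (hp : p ≠ 0) : p.toPoly.natDegree = p.deg := by
  refine p.natDegree_toPoly_le.antisymm (le_natDegree_of_ne_zero ?_)
  rw [deg_eq, coeff_toPoly]
  exact coeff_tauDeg_ne_zero hp

/-- The two sides are compared as functions on the algebraic closure, which is infinite even if `K`
is finite. -/
theorem toPoly_mul (p s : TwistedPoly Fq K) : (p * s).toPoly = p.toPoly.comp s.toPoly := by
  refine map_injective _ (algebraMap K (AlgebraicClosure K)).injective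
    (Polynomial.funext fun x ↦ ?_)
  rw [Polynomial.map_comp, eval_comp]
  simp only [eval_map_algebraMap, aeval_toPoly, eval_mul]

theorem mul_ne_zero' {p s : TwistedPoly Fq K} (hp : p ≠ 0) (hs : s ≠ 0) : p * s ≠ 0 := by
  intro h
  have h1 := natDegree_comp (p := p.toPoly) (q := s.toPoly)
  rw [← toPoly_mul] at h1
  rw [h, natDegree_toPoly hp, natDegree_toPoly hs, deg_eq, deg_eq] at h1
  have : (0 : TwistedPoly Fq K).toPoly = 0 := rfl
  rw [this, natDegree_zero] at h1
  exact mul_ne_zero (card_pow_ne_zero _) (card_pow_ne_zero _) h1.symm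

theorem deg_mul {p s : TwistedPoly Fq K} (hp : p ≠ 0) (hs : s ≠ 0) :
    (p * s).deg = p.deg * s.deg := by
  rw [← natDegree_toPoly hp, ← natDegree_toPoly hs, ← natDegree_toPoly (mul_ne_zero' hp hs),
    toPoly_mul, natDegree_comp]

theorem deg_one : (1 : TwistedPoly Fq K).deg = 1 := by
  have h : (1 : TwistedPoly Fq K).toPoly = X := by
    refine map_injective _ (algebraMap K (AlgebraicClosure K)).injective
      (Polynomial.funext fun x ↦ ?_)
    rw [eval_map_algebraMap, aeval_toPoly, eval_one]
    simp
  have h1 : (1 : TwistedPoly Fq K) ≠ 0 := fun h0 ↦ by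
    rw [h0] at h
    exact X_ne_zero h.symm
  rw [← natDegree_toPoly h1, h, natDegree_X]

theorem pow_ne_zero' {p : TwistedPoly Fq K} (hp : p ≠ 0) (n : ℕ) : p ^ n ≠ 0 := by
  induction n with
  | zero =>
    intro h
    have h1 := eval_one (Fq := Fq) (K := K) (1 : K)
    rw [← pow_zero p, h, eval_zero_left] at h1
    exact one_ne_zero h1.symm
  | succ n ih => rw [pow_succ]; exact mul_ne_zero' ih hp

theorem deg_pow {p : TwistedPoly Fq K} (hp : p ≠ 0) (n : ℕ) : (p ^ n).deg = p.deg ^ n := by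
  induction n with
  | zero => simp [deg_one]
  | succ n ih => rw [pow_succ, deg_mul (pow_ne_zero' hp n) hp, ih, pow_succ]

/-- A twisted polynomial of degree `0` in `τ` acts by multiplication. -/
theorem eval_of_tauDeg_eq_zero {p : TwistedPoly Fq K} (h : p.tauDeg = 0) (x : L) :
    p.eval x = algebraMap K L (p.coeff 0) * x := by
  have hs : p.support ⊆ {0} := fun i hi ↦ by
    have := le_tauDeg (mem_support.1 hi)
    simp; omega
  rw [eval, Finset.sum_subset hs fun i _ hi ↦ by
    rw [mem_support, not_not] at hi; simp [hi]]
  simp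

/-- A twisted polynomial that commutes with a constant not fixed by any power of Frobenius has
degree `0` in `τ`. -/
theorem tauDeg_eq_zero_of_commute {p s : TwistedPoly Fq K} (h : Commute p s) (hp : p.tauDeg = 0)
    (hp0 : ∀ n ≠ 0, p.coeff 0 ^ (Fintype.card Fq ^ n) ≠ p.coeff 0) : s.tauDeg = 0 := by
  by_contra hs
  have hs0 : s ≠ 0 := by rintro rfl; exact hs rfl
  set c := p.coeff 0 with hc
  have hpoly : C c * s.toPoly = s.toPoly.comp (C c * X) := by
    refine map_injective _ (algebraMap K (AlgebraicClosure K)).injective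
      (Polynomial.funext fun x ↦ ?_)
    rw [Polynomial.map_comp, eval_comp, Polynomial.map_mul, Polynomial.eval_mul,
      Polynomial.map_mul, Polynomial.eval_mul]
    simp only [eval_map_algebraMap, aeval_toPoly, aeval_C, map_X, eval_X]
    rw [← eval_of_tauDeg_eq_zero hp, ← eval_of_tauDeg_eq_zero hp, ← eval_mul, ← eval_mul, h.eq]
  -- The top coefficient b of `s` satisfies bc = bc^(q^n) with n = `s.tauDeg`, so c is fixed by a
  -- power of Frobenius.
  have h1 := congrArg (fun f ↦ f.coeff (Fintype.card Fq ^ s.tauDeg)) hpoly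
  simp only [coeff_C_mul, comp_C_mul_X_coeff, coeff_toPoly] at h1
  rw [mul_comm] at h1
  exact hp0 _ hs (mul_left_cancel₀ (coeff_tauDeg_ne_zero hs0) h1).symm

end TwistedPoly
end LocalLehmer

/-! ### Extension of valuations, and roots of additive polynomials -/

namespace LocalLehmer

/-- Every valuation subring extends along a homomorphism of fields. -/
theorem exists_valuationSubring_mem_iff {L Ω : Type*} [Field L] [Field Ω] (f : L →+* Ω)
    (O : ValuationSubring L) : ∃ B : ValuationSubring Ω, ∀ x, f x ∈ B ↔ x ∈ O := by
  -- `B` dominates the image of `O`: an element of `O` that becomes a unit in `B` is already a unit,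
  -- which is applied to `x⁻¹`.
  obtain ⟨B, hB, hloc⟩ := IsLocalRing.exists_factor_valuationRing (f.comp O.subtype)
  have hmem : ∀ x ∈ O, f x ∈ B := fun x hx ↦ hB ⟨x, hx⟩
  refine ⟨B, fun x ↦ ⟨fun hx ↦ ?_, hmem x⟩⟩
  by_contra hxO
  have hx0 : x ≠ 0 := fun h ↦ hxO (h ▸ O.zero_mem)
  have hinv : x⁻¹ ∈ O := (O.mem_or_inv_mem x).resolve_left hxO
  have hu : IsUnit ((f.comp O.subtype).codRestrict B.toSubring hB ⟨x⁻¹, hinv⟩) := by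
    refine IsUnit.of_mul_eq_one ⟨f x, hx⟩ (Subtype.ext ?_)
    change f x⁻¹ * f x = 1
    rw [← map_mul, inv_mul_cancel₀ hx0, map_one]
  obtain ⟨y, hy⟩ := isUnit_iff_exists_inv.1 (hloc.map_nonunit _ hu)
  have hy' : x⁻¹ * (y : L) = 1 := congrArg Subtype.val hy
  have : (y : L) = x := by field_simp at hy'; exact hy'
  exact hxO (this ▸ y.2)

/-- The value group of `B` need not be `Γ`; only comparisons are transferred, and the root estimates
use nothing else. -/
theorem exists_valuation_map_le_iff {L Ω Γ : Type*} [Field L] [Field Ω]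
    [LinearOrderedCommGroupWithZero Γ] (f : L →+* Ω) (v : Valuation L Γ) :
    ∃ B : ValuationSubring Ω, ∀ x y, B.valuation (f x) ≤ B.valuation (f y) ↔ v x ≤ v y := by
  obtain ⟨B, hB⟩ := exists_valuationSubring_mem_iff f v.valuationSubring
  refine ⟨B, fun x y ↦ ?_⟩
  rcases eq_or_ne y 0 with rfl | hy
  · simp
  · have hy1 : B.valuation (f y) ≠ 0 := by simpa using hy
    have hy2 : v y ≠ 0 := by simpa using hy
    have := hB (x / y)
    rw [← B.valuation_le_one_iff, Valuation.mem_valuationSubring_iff, map_div₀, map_div₀,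
      map_div₀, div_le_one₀ (zero_lt_iff.2 hy1), div_le_one₀ (zero_lt_iff.2 hy2)] at this
    exact this

section NearRoot

open Polynomial

/-- The coefficient of X^k is, up to sign, a sum of products of the roots with k of them omitted,
and each omitted root has size at least `ρ`. -/
theorem coeff_prod_mul_pow_le {Ω Γ : Type*} [Field Ω] [LinearOrderedCommGroupWithZero Γ]
    (w : Valuation Ω Γ) {ρ : Γ} (s : Multiset Ω) (h : ∀ z ∈ s, ρ ≤ w z) (k : ℕ) :
    w ((s.map fun z ↦ X - C z).prod.coeff k) * ρ ^ k ≤ w ((s.map fun z ↦ X - C z).prod.coeff 0) := by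
  induction s using Multiset.induction_on generalizing k with
  | empty =>
    rcases k with _ | k
    · simp
    · simp [coeff_one]
  | cons a s ih =>
    rw [Multiset.map_cons, Multiset.prod_cons]
    set Q := (s.map fun z ↦ X - C z).prod
    have ih := ih fun z hz ↦ h z (Multiset.mem_cons_of_mem hz)
    have ha := h a (Multiset.mem_cons_self a s)
    rcases k with _ | k
    · simp
    · have h0 : w (((X - C a) * Q).coeff 0) = w a * w (Q.coeff 0) := by
        simp [sub_mul, Valuation.map_neg]
      have h1 : ((X - C a) * Q).coeff (k + 1) = Q.coeff k - a * Q.coeff (k + 1) := by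
        simp [sub_mul]
      rw [h0, h1]
      have h2 : w (Q.coeff k) * ρ ^ (k + 1) ≤ w a * w (Q.coeff 0) := by
        rw [pow_succ, ← mul_assoc, mul_comm (w a)]
        exact mul_le_mul' (ih k) ha
      have h3 : w (a * Q.coeff (k + 1)) * ρ ^ (k + 1) ≤ w a * w (Q.coeff 0) := by
        rw [map_mul, mul_assoc]
        exact mul_le_mul_right (ih (k + 1)) _
      rcases le_max_iff.1 (w.map_sub (Q.coeff k) (a * Q.coeff (k + 1))) with h4 | h4
      · exact (mul_le_mul_left h4 _).trans h2
      · exact (mul_le_mul_left h4 _).trans h3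

variable {Fq K : Type*} [Field Fq] [Fintype Fq] [Field K] [Algebra Fq K]

/-- If the value of an additive polynomial at `u` is smaller than the maximum of one of its terms on
a disc of radius `ρ`, then `u` is at distance less than `ρ` from a root. -/
theorem TwistedPoly.exists_root_near {Ω Γ : Type*} [Field Ω] [IsAlgClosed Ω] [Algebra K Ω]
    [Algebra Fq Ω] [LinearOrderedCommGroupWithZero Γ] (w : Valuation Ω Γ) (p : TwistedPoly Fq K)
    (u : Ω) (ρ : Γ) (i : ℕ)
    (h : w (p.eval u) < w (algebraMap K Ω (p.coeff i)) * ρ ^ (Fintype.card Fq ^ i)) :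
    ∃ z ∈ (p.toPoly.map (algebraMap K Ω)).roots, w (u - z) < ρ := by
  by_contra! hroots
  refine h.not_ge ?_
  set f := p.toPoly.map (algebraMap K Ω) with hf
  have hfeval : ∀ x, f.eval x = p.eval x := fun x ↦ by
    rw [hf, eval_map_algebraMap, TwistedPoly.aeval_toPoly]
  -- By additivity, translation by `u` changes only the constant term, from 0 to p(u). The roots
  -- become z − u, all of size at least `ρ` by assumption.
  have hcomp : f.comp (X + C u) = f + C (p.eval u) := by
    refine Polynomial.funext fun x ↦ ?_
    simp only [eval_comp, Polynomial.eval_add, eval_X, eval_C, hfeval, TwistedPoly.eval_add]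
  have hprod : f.comp (X + C u) =
      C f.leadingCoeff * ((f.roots.map fun z ↦ z - u).map fun z ↦ X - C z).prod := by
    conv_lhs => rw [(IsAlgClosed.splits f).eq_prod_roots]
    rw [mul_comp, C_comp, multiset_prod_comp, Multiset.map_map, Multiset.map_map]
    congr 3
    ext1 z
    simp only [Function.comp, sub_comp, X_comp, C_comp, map_sub]
    ring
  have key := coeff_prod_mul_pow_le w (ρ := ρ) (f.roots.map fun z ↦ z - u) (by
    intro z hz
    obtain ⟨y, hy, rfl⟩ := Multiset.mem_map.1 hz
    rw [Valuation.map_sub_swap]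
    exact hroots y hy) (Fintype.card Fq ^ i)
  have key2 := mul_le_mul_right key (w f.leadingCoeff)
  rw [← mul_assoc, ← map_mul, ← map_mul, ← coeff_C_mul, ← coeff_C_mul, ← hprod, hcomp] at key2
  rw [Polynomial.coeff_add, Polynomial.coeff_add, coeff_C_zero,
    coeff_C_of_ne_zero (TwistedPoly.card_pow_ne_zero i), add_zero, coeff_zero_eq_eval_zero, hfeval,
    TwistedPoly.eval_zero, zero_add, hf, coeff_map, TwistedPoly.coeff_toPoly] at key2
  exact key2

end NearRoot

variable {Fq K L : Type*} [Field Fq] [Fintype Fq] [Field K] [Algebra Fq K]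
  [Field L] [Algebra K L] [Algebra Fq L]

/-! ### Dimension count for spaces on which p is small -/

namespace TwistedPoly

/-- A finite-dimensional space of elements of absolute value at least `|π|` on which the values of
an additive polynomial are small has dimension at most the degree in `τ`. -/
theorem finrank_le_tauDeg (v : Valuation L ℤᵐ⁰) (p : TwistedPoly Fq K) (i : ℕ) (π : L)
    (U : Submodule Fq L) [FiniteDimensional Fq U] (hU : ∀ u ∈ U, u ≠ 0 → v π ≤ v u)
    (hpU : ∀ u ∈ U,
      v (p.eval u) < v (algebraMap K L (p.coeff i) * π ^ (Fintype.card Fq ^ i))) :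
    Module.finrank Fq U ≤ p.tauDeg := by
  classical
  let Ω := AlgebraicClosure L
  obtain ⟨B, hB⟩ := exists_valuation_map_le_iff (algebraMap L Ω) v
  have hBlt : ∀ x y, B.valuation (algebraMap L Ω x) < B.valuation (algebraMap L Ω y) ↔ v x < v y :=
    fun x y ↦ by rw [← not_le, ← not_le, hB]
  set R := (p.toPoly.map (algebraMap K Ω)).roots
  have heval : ∀ u : L, p.eval (algebraMap L Ω u) = algebraMap L Ω (p.eval u) := fun u ↦ by
    rw [← aeval_toPoly, ← aeval_toPoly, Polynomial.aeval_algebraMap_apply]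
  have hnear : ∀ u : U, ∃ z ∈ R, B.valuation (algebraMap L Ω u - z) <
      B.valuation (algebraMap L Ω π) := fun u ↦ by
    refine exists_root_near B.valuation p _ _ i ?_
    rw [heval, IsScalarTower.algebraMap_apply K L Ω, ← map_pow, ← map_mul, ← map_pow, ← map_mul,
      hBlt]
    exact hpU u u.2
  choose g hgR hg using hnear
  -- Two elements of `U` near the same root would differ by less than |π|.
  have hinj : Function.Injective fun u ↦ (⟨g u, Multiset.mem_toFinset.2 (hgR u)⟩ : R.toFinset) := by
    intro u u' huu
    have huu : g u = g u' := congrArg Subtype.val huu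
    by_contra hne
    have h1 : (u : L) - u' ≠ 0 := sub_ne_zero.2 fun h ↦ hne (Subtype.ext h)
    have h2 := hU _ (U.sub_mem u.2 u'.2) h1
    rw [← hB] at h2
    refine h2.not_gt ?_
    have h3 : algebraMap L Ω (u - u') =
        (algebraMap L Ω u - g u) - (algebraMap L Ω u' - g u') := by rw [huu, map_sub]; ring
    rw [h3]
    exact (Valuation.map_sub _ _ _).trans_lt (max_lt (hg u) (hg u'))
  have hcard : Nat.card U ≤ p.deg := by
    refine (Nat.card_le_card_of_injective _ hinj).trans ?_
    rw [Nat.card_eq_fintype_card, Fintype.card_coe]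
    refine (Multiset.toFinset_card_le _).trans ((Polynomial.card_roots' _).trans ?_)
    exact (Polynomial.natDegree_map_le).trans p.natDegree_toPoly_le
  rw [Module.natCard_eq_pow_finrank (K := Fq), Nat.card_eq_fintype_card, deg_eq] at hcard
  exact (Nat.pow_le_pow_iff_right Fintype.one_lt_card).1 hcard

theorem _root_.Valuation.map_smul_le_of_finite (v : Valuation L ℤᵐ⁰) (c : Fq) (x : L) :
    v (c • x) ≤ v x := by
  rw [Algebra.smul_def, map_mul]
  exact mul_le_of_le_one_left' (map_le_one_of_finite v c)

/-- If the nonzero elements of a space of large dimension have absolute value at least `|π|`, then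
one of them is moved away from `0` as fast as `π` is under iteration of one of the terms. -/
theorem exists_le_iterate_eval (v : Valuation L ℤᵐ⁰) {p : TwistedPoly Fq K} {i : ℕ}
    (hi : p.coeff i ≠ 0) (n : ℕ) (π : L) (hπ : π ≠ 0)
    (U : Submodule Fq L) [FiniteDimensional Fq U] (hU : ∀ u ∈ U, u ≠ 0 → v π ≤ v u)
    (hdim : p.tauDeg * n < Module.finrank Fq U) :
    ∃ u ∈ U, v ((fun z ↦ algebraMap K L (p.coeff i) * z ^ (Fintype.card Fq ^ i))^[n] π) ≤
      v (p.eval^[n] u) := by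
  induction n generalizing π U with
  | zero =>
    have : Nontrivial U := Module.nontrivial_of_finrank_pos (R := Fq) (by omega)
    obtain ⟨u, hu⟩ := exists_ne (0 : U)
    exact ⟨u, u.2, hU u u.2 (by simpa using hu)⟩
  | succ n ih =>
    set π' := algebraMap K L (p.coeff i) * π ^ (Fintype.card Fq ^ i) with hπ'
    have hπ0 : π' ≠ 0 := mul_ne_zero (by simpa using hi) (pow_ne_zero _ hπ)
    have hv0 : 0 < v π' := zero_lt_iff.2 (by simpa using hπ0)
    -- The part of `U` that p sends below |π'| has dimension at most the degree in τ. On a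
    -- complement p is injective, and the image satisfies the induction hypothesis with π'.
    let S : Submodule Fq U :=
      { carrier := {u | v (p.eval (u : L)) < v π'}
        zero_mem' := by simpa [eval_zero] using hv0
        add_mem' := fun {a b} ha hb ↦ by
          simp only [Set.mem_ofPred_eq, Submodule.coe_add, eval_add] at *
          exact v.map_add_lt ha hb
        smul_mem' := fun c a ha ↦ by
          simp only [Set.mem_ofPred_eq, Submodule.coe_smul, eval_smul] at *
          exact (v.map_smul_le_of_finite c _).trans_lt ha }
    have hSdim : Module.finrank Fq S ≤ p.tauDeg := by
      rw [← Submodule.finrank_map_subtype_eq U S]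
      refine finrank_le_tauDeg v p i π (S.map U.subtype) ?_ ?_
      · rintro _ ⟨u, -, rfl⟩
        exact hU u u.2
      · rintro _ ⟨u, hu, rfl⟩
        exact hu
    obtain ⟨W, hW⟩ := S.exists_isCompl
    have hWdim := Submodule.finrank_add_eq_of_isCompl hW
    let g : W →ₗ[Fq] L := (p.evalLin L).comp (U.subtype.comp W.subtype)
    have hgW : ∀ w : W, w ≠ 0 → v π' ≤ v (g w) := fun w hw ↦ by
      by_contra! hlt
      exact hw (Subtype.ext (Submodule.disjoint_def.1 hW.disjoint w hlt w.2))
    have hginj : Function.Injective g := by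
      intro w w' hww
      by_contra hne
      have h1 := hgW (w - w') (sub_ne_zero.2 hne)
      have h2 : g (w - w') = 0 := (map_sub (p.evalLin L) ((w : U) : L) ((w' : U) : L)).trans (sub_eq_zero.2 hww)
      rw [h2, map_zero] at h1
      exact h1.not_gt hv0
    have hrange : Module.finrank Fq (LinearMap.range g) = Module.finrank Fq W :=
      LinearMap.finrank_range_of_inj hginj
    obtain ⟨_, ⟨w, rfl⟩, hw⟩ := ih π' hπ0 (LinearMap.range g) (by
      rintro _ ⟨w, rfl⟩ hne
      exact hgW w (by rintro rfl; exact hne (map_zero g))) (by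
      rw [hrange]
      rw [mul_add, mul_one] at hdim
      omega)
    exact ⟨w, w.1.2, hw⟩

end TwistedPoly
end LocalLehmer

/-! ### Escape rates -/

namespace LocalLehmer
open WithZero Filter Topology

/-- If a function grows by a factor `D` along `T` up to a bounded error, then its normalized limit
along the iterates of `T` exists and stays close to it. -/
theorem exists_tendsto_iterate_div_pow {X : Type*} (T : X → X) (h : X → ℝ) {D c : ℝ} (hD : 1 < D)
    (hT : ∀ x, |h (T x) - D * h x| ≤ c) (x : X) :
    ∃ l, Tendsto (fun n ↦ h (T^[n] x) / D ^ n) atTop (𝓝 l) ∧ |l - h x| ≤ c / (D - 1) := by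
  have hD0 : 0 < D := by linarith
  -- Tate's telescoping: the error c of one step is divided by D^(n+1), and the geometric series
  -- sums to c/(D − 1).
  have hdist : ∀ n, dist (h (T^[n] x) / D ^ n) (h (T^[n + 1] x) / D ^ (n + 1)) ≤
      c / D * D⁻¹ ^ n := by
    intro n
    rw [dist_comm, Real.dist_eq, Function.iterate_succ_apply']
    have h1 : h (T (T^[n] x)) / D ^ (n + 1) - h (T^[n] x) / D ^ n =
        (h (T (T^[n] x)) - D * h (T^[n] x)) / D ^ (n + 1) := by
      field_simp
      ring
    rw [h1, abs_div, abs_of_pos (pow_pos hD0 _), inv_pow, pow_succ', div_mul_eq_mul_div,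
      div_le_div_iff₀ (by positivity) hD0]
    have := hT (T^[n] x)
    have h2 : c * (D ^ n)⁻¹ * (D * D ^ n) = c * D := by field_simp
    rw [h2]
    gcongr
  have hr : D⁻¹ < 1 := inv_lt_one_of_one_lt₀ hD
  obtain ⟨l, hl⟩ := cauchySeq_tendsto_of_complete (cauchySeq_of_le_geometric _ _ hr hdist)
  refine ⟨l, hl, ?_⟩
  have := dist_le_of_le_geometric_of_tendsto₀ _ _ hr hdist hl
  rw [dist_comm, Real.dist_eq] at this
  simp only [Function.iterate_zero, id, pow_zero, div_one] at this
  convert this using 1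
  have : D - 1 ≠ 0 := by linarith
  field_simp

section LogPlus

variable {L : Type*} [Field L] (v : Valuation L ℤᵐ⁰)

/-- `max {0, log |x|}`. -/
def logPlus (x : L) : ℤ := max 0 (log (v x))

theorem truncOrd_eq_neg_logPlus (x : L) : truncOrd v x = -logPlus v x := by
  rw [truncOrd, logPlus]
  omega

theorem logPlus_nonneg (x : L) : 0 ≤ logPlus v x := le_max_left _ _

variable {v}

theorem logPlus_le_iff {x : L} {k : ℤ} (hk : 0 ≤ k) : logPlus v x ≤ k ↔ v x ≤ exp k := by
  rw [logPlus, max_le_iff]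
  rcases eq_or_ne (v x) 0 with h | h
  · simp [h, hk]
  · rw [log_le_iff_le_exp h]
    simp [hk]

theorem le_exp_logPlus (x : L) : v x ≤ exp (logPlus v x) :=
  (logPlus_le_iff (logPlus_nonneg v x)).1 le_rfl

theorem logPlus_le_logPlus {x y : L} (h : v x ≤ v y) : logPlus v x ≤ logPlus v y :=
  (logPlus_le_iff (logPlus_nonneg v y)).2 (h.trans (le_exp_logPlus y))

end LogPlus

namespace TwistedPoly

variable {Fq K L : Type*} [Field Fq] [Fintype Fq] [Field K] [Algebra Fq K]
  [Field L] [Algebra K L]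

/-- The nonzero coefficients of `p` have logarithmic size at most `Λ`. -/
def CoeffBound (v : Valuation L ℤᵐ⁰) (p : TwistedPoly Fq K) (Λ : ℤ) : Prop :=
  ∀ i, p.coeff i ≠ 0 → |log (v (algebraMap K L (p.coeff i)))| ≤ Λ

theorem exists_coeffBound (v : Valuation L ℤᵐ⁰) (p : TwistedPoly Fq K) :
    ∃ Λ, CoeffBound v p Λ := by
  refine ⟨∑ i ∈ p.support, |log (v (algebraMap K L (p.coeff i)))|, fun i hi ↦ ?_⟩
  exact Finset.single_le_sum
    (f := fun i ↦ |log (v (algebraMap K L (p.coeff i)))|) (fun _ _ ↦ abs_nonneg _)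
    (mem_support.2 hi)

variable {v : Valuation L ℤᵐ⁰} {p : TwistedPoly Fq K} {Λ : ℤ}

theorem CoeffBound.nonneg (h : CoeffBound v p Λ) (hp : p ≠ 0) : 0 ≤ Λ :=
  (abs_nonneg _).trans (h _ (coeff_tauDeg_ne_zero hp))

theorem deg_pos (p : TwistedPoly Fq K) : 0 < p.deg := pow_pos Fintype.card_pos _

theorem card_pow_le_deg {i : ℕ} (hi : p.coeff i ≠ 0) : Fintype.card Fq ^ i ≤ p.deg :=
  Nat.pow_le_pow_right Fintype.card_pos (le_tauDeg hi)

theorem map_coeff_ne_zero (v : Valuation L ℤᵐ⁰) {i : ℕ} (hi : p.coeff i ≠ 0) :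
    v (algebraMap K L (p.coeff i)) ≠ 0 := by
  simpa using hi

theorem CoeffBound.logPlus_eval_le (h : CoeffBound v p Λ) (hp : p ≠ 0) (y : L) :
    logPlus v (p.eval y) ≤ p.deg * logPlus v y + Λ := by
  have h0 := logPlus_nonneg v y
  have hΛ := h.nonneg hp
  rw [logPlus_le_iff (by positivity)]
  refine v.map_sum_le fun i hi ↦ ?_
  rw [mem_support] at hi
  rw [map_mul, map_pow, add_comm, exp_add]
  refine mul_le_mul' (le_exp_of_log_le (le_of_abs_le (h i hi))) ?_
  refine (pow_le_pow_left₀ zero_le (le_exp_logPlus y) _).trans ?_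
  rw [← exp_nsmul, exp_le_exp, nsmul_eq_mul]
  exact mul_le_mul_of_nonneg_right (mod_cast card_pow_le_deg hi) h0

/-- The top term dominates: its logarithm is at least D log|y| − Λ, and any other is at most (D − 1)
log|y| + Λ. -/
theorem CoeffBound.map_eval_eq (h : CoeffBound v p Λ) (hp : p ≠ 0) {y : L}
    (hy : 2 * Λ < log (v y)) :
    v (p.eval y) = v (algebraMap K L (p.coeff p.tauDeg)) * v y ^ p.deg := by
  classical
  have hΛ := h.nonneg hp
  have hy0 : v y ≠ 0 := fun h0 ↦ by rw [h0, log_zero] at hy; omega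
  have hr := coeff_tauDeg_ne_zero hp
  have hterm : ∀ i, v (algebraMap K L (p.coeff i) * y ^ (Fintype.card Fq ^ i)) =
      v (algebraMap K L (p.coeff i)) * v y ^ (Fintype.card Fq ^ i) := fun i ↦ by
    rw [map_mul, map_pow]
  rw [eval, v.map_sum_eq_of_lt (mem_support.2 hr), hterm, deg_eq]
  intro i hi
  simp only [Finset.mem_sdiff, Finset.mem_singleton, mem_support] at hi
  have hlt : Fintype.card Fq ^ i < p.deg :=
    Nat.pow_lt_pow_right Fintype.one_lt_card (lt_of_le_of_ne (le_tauDeg hi.1) hi.2)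
  have ha := map_coeff_ne_zero v hi.1
  have har := map_coeff_ne_zero v hr
  rw [hterm, hterm, ← deg_eq, ← log_lt_log (mul_ne_zero ha (pow_ne_zero _ hy0))
    (mul_ne_zero har (pow_ne_zero _ hy0)), log_mul ha (pow_ne_zero _ hy0),
    log_mul har (pow_ne_zero _ hy0), log_pow, log_pow, nsmul_eq_mul, nsmul_eq_mul]
  have h1 := abs_le.1 (h i hi.1)
  have h2 := abs_le.1 (h _ hr)
  have h3 : ((Fintype.card Fq ^ i : ℕ) : ℤ) + 1 ≤ p.deg := mod_cast hlt
  nlinarith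

/-- If log⁺|y| ≤ 2Λ the error term alone suffices; otherwise the top term dominates. -/
theorem CoeffBound.le_logPlus_eval (h : CoeffBound v p Λ) (hp : p ≠ 0) (y : L) :
    p.deg * logPlus v y ≤ logPlus v (p.eval y) + 2 * p.deg * Λ := by
  have hΛ := h.nonneg hp
  have hD : (1 : ℤ) ≤ p.deg := mod_cast p.deg_pos
  have h0 := logPlus_nonneg v (p.eval y)
  rcases le_or_gt (logPlus v y) (2 * Λ) with hy | hy
  · nlinarith
  · have hy1 : 2 * Λ < log (v y) := by
      rw [logPlus, lt_max_iff] at hy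
      omega
    have hy0 : v y ≠ 0 := fun h0 ↦ by rw [h0, log_zero] at hy1; omega
    have hr := coeff_tauDeg_ne_zero hp
    have h1 : log (v (p.eval y)) ≤ logPlus v (p.eval y) := le_max_right _ _
    rw [h.map_eval_eq hp hy1, log_mul (map_coeff_ne_zero v hr) (pow_ne_zero _ hy0), log_pow,
      nsmul_eq_mul] at h1
    have h2 := abs_le.1 (h _ hr)
    have h3 : logPlus v y = log (v y) := max_eq_right (by omega)
    rw [h3]
    nlinarith

theorem CoeffBound.abs_logPlus_eval_sub_le (h : CoeffBound v p Λ) (hp : p ≠ 0) (y : L) :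
    |(logPlus v (p.eval y) : ℝ) - p.deg * logPlus v y| ≤ 2 * p.deg * Λ := by
  have h1 := h.logPlus_eval_le hp y
  have h2 := h.le_logPlus_eval hp y
  have hΛ := h.nonneg hp
  have hD : (1 : ℤ) ≤ p.deg := mod_cast p.deg_pos
  have h3 : Λ ≤ 2 * p.deg * Λ := by nlinarith
  have h4 : |logPlus v (p.eval y) - p.deg * logPlus v y| ≤ 2 * p.deg * Λ :=
    abs_le.2 ⟨by linarith, by linarith⟩
  exact_mod_cast h4

variable (v p) in
/-- The normalized rate of escape of `y` under iteration of `p`. -/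
def escapeRate (y : L) : ℝ := limUnder atTop fun n ↦ (logPlus v (p.eval^[n] y) : ℝ) / p.deg ^ n

theorem CoeffBound.escapeRate_spec (h : CoeffBound v p Λ) (hp : p ≠ 0) (hD : 1 < p.deg) (y : L) :
    Tendsto (fun n ↦ (logPlus v (p.eval^[n] y) : ℝ) / p.deg ^ n) atTop (𝓝 (escapeRate v p y)) ∧
      |escapeRate v p y - logPlus v y| ≤ 4 * Λ := by
  have hD' : (1 : ℝ) < p.deg := mod_cast hD
  obtain ⟨l, hl, hle⟩ := exists_tendsto_iterate_div_pow p.eval (fun y ↦ (logPlus v y : ℝ)) hD'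
    (h.abs_logPlus_eval_sub_le hp) y
  have : escapeRate v p y = l := hl.limUnder_eq
  rw [this]
  refine ⟨hl, hle.trans ?_⟩
  have hD2 : (2 : ℝ) ≤ p.deg := mod_cast hD
  have hΛ : (0 : ℝ) ≤ Λ := mod_cast h.nonneg hp
  rw [div_le_iff₀ (by linarith)]
  nlinarith

theorem tendsto_escapeRate (v : Valuation L ℤᵐ⁰) (hp : p ≠ 0) (hD : 1 < p.deg) (y : L) :
    Tendsto (fun n ↦ (logPlus v (p.eval^[n] y) : ℝ) / p.deg ^ n) atTop
      (𝓝 (escapeRate v p y)) := by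
  obtain ⟨Λ, hΛ⟩ := exists_coeffBound v p
  exact (hΛ.escapeRate_spec hp hD y).1

theorem escapeRate_nonneg (v : Valuation L ℤᵐ⁰) (hp : p ≠ 0) (hD : 1 < p.deg) (y : L) :
    0 ≤ escapeRate v p y := by
  refine ge_of_tendsto' (tendsto_escapeRate v hp hD y) fun n ↦ ?_
  have : (0 : ℝ) ≤ logPlus v (p.eval^[n] y) := mod_cast logPlus_nonneg v _
  positivity

theorem tendsto_inv_deg_pow (hD : 1 < p.deg) (c : ℝ) :
    Tendsto (fun n ↦ c / (p.deg : ℝ) ^ n) atTop (𝓝 0) :=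
  tendsto_const_nhds.div_atTop (tendsto_pow_atTop_atTop_of_one_lt (mod_cast hD))

section Commute

variable [Algebra Fq L] {s : TwistedPoly Fq K}

/-- Commuting twisted polynomials are compatible with the rate of escape. -/
theorem escapeRate_eval_of_commute (v : Valuation L ℤᵐ⁰) (hp : p ≠ 0) (hD : 1 < p.deg) (hs : s ≠ 0)
    (hps : Commute p s) (y : L) : escapeRate v p (s.eval y) = s.deg * escapeRate v p y := by
  obtain ⟨Λ, hΛ⟩ := exists_coeffBound v s
  have hcomm : ∀ n, p.eval^[n] (s.eval y) = s.eval (p.eval^[n] y) := fun n ↦ by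
    rw [← eval_pow, ← eval_pow, ← eval_mul, ← eval_mul, (hps.pow_left n).eq]
  refine tendsto_nhds_unique (tendsto_escapeRate v hp hD (s.eval y)) ?_
  have h1 := (tendsto_escapeRate v hp hD y).const_mul (s.deg : ℝ)
  refine h1.congr_dist (squeeze_zero (fun _ ↦ dist_nonneg) (fun n ↦ ?_)
    (tendsto_inv_deg_pow hD (2 * s.deg * Λ)))
  have hDpos : (0 : ℝ) < (p.deg : ℝ) ^ n := pow_pos (mod_cast p.deg_pos) n
  rw [dist_comm, Real.dist_eq, hcomm, mul_div_assoc', ← sub_div, abs_div, abs_of_pos hDpos]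
  gcongr
  exact hΛ.abs_logPlus_eval_sub_le hs _

theorem escapeRate_iterate_of_commute (v : Valuation L ℤᵐ⁰) (hp : p ≠ 0) (hD : 1 < p.deg)
    (hs : s ≠ 0) (hps : Commute p s) (n : ℕ) (y : L) :
    escapeRate v p (s.eval^[n] y) = s.deg ^ n * escapeRate v p y := by
  induction n with
  | zero => simp
  | succ n ih =>
    rw [Function.iterate_succ_apply', escapeRate_eval_of_commute v hp hD hs hps, ih, pow_succ']
    ring

theorem escapeRate_eq_of_commute (v : Valuation L ℤᵐ⁰) (hp : p ≠ 0) (hD : 1 < p.deg)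
    (hs : s ≠ 0) (hDs : 1 < s.deg) (hps : Commute p s) (y : L) :
    escapeRate v s y = escapeRate v p y := by
  obtain ⟨Λ, hΛ⟩ := exists_coeffBound v p
  refine tendsto_nhds_unique (tendsto_escapeRate v hs hDs y) ?_
  refine (tendsto_const_nhds (x := escapeRate v p y)).congr_dist
    (squeeze_zero (fun _ ↦ dist_nonneg) (fun n ↦ ?_) (tendsto_inv_deg_pow hDs (4 * Λ)))
  have hDpos : (0 : ℝ) < (s.deg : ℝ) ^ n := pow_pos (mod_cast s.deg_pos) n
  -- Along the orbit under `s`, the escape rate for `p` is multiplied exactly by the degree of `s`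
  -- and stays within 4Λ of log⁺; dividing by the power of that degree kills the error.
  have h1 := (hΛ.escapeRate_spec hp hD (s.eval^[n] y)).2
  rw [escapeRate_iterate_of_commute v hp hD hs hps] at h1
  have h2 : escapeRate v p y - logPlus v (s.eval^[n] y) / (s.deg : ℝ) ^ n =
      (s.deg ^ n * escapeRate v p y - logPlus v (s.eval^[n] y)) / (s.deg : ℝ) ^ n := by
    field_simp
  rw [Real.dist_eq, h2, abs_div, abs_of_pos hDpos]
  gcongr

end Commute

end TwistedPoly
end LocalLehmer

/-! ### The stable disc and the lower bound for escape rates -/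

namespace LocalLehmer
open WithZero Filter Topology
namespace TwistedPoly

variable {Fq K L : Type*} [Field Fq] [Fintype Fq] [Field K] [Algebra Fq K]
  [Field L] [Algebra K L] {v : Valuation L ℤᵐ⁰} {p : TwistedPoly Fq K} {Λ : ℤ}

variable (v p) in
/-- `u` lies in the disc around `0` on which no term of `p` other than the linear one expands. -/
def InStableDisc (u : L) : Prop :=
  ∀ i, i ≠ 0 → v (algebraMap K L (p.coeff i)) * v u ^ (Fintype.card Fq ^ i - 1) ≤ 1

theorem inStableDisc_zero : InStableDisc v p 0 := by
  intro i hi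
  have : Fintype.card Fq ^ i - 1 ≠ 0 :=
    (Nat.sub_pos_of_lt (Nat.one_lt_pow hi Fintype.one_lt_card)).ne'
  simp [this]

theorem InStableDisc.mono {u u' : L} (h : InStableDisc v p u) (hu : v u' ≤ v u) :
    InStableDisc v p u' := fun i hi ↦
  (mul_le_mul_right (pow_le_pow_left₀ zero_le hu _) _).trans (h i hi)

theorem InStableDisc.map_eval_le {u : L} (h : InStableDisc v p u)
    (h0 : v (algebraMap K L (p.coeff 0)) ≤ 1) : v (p.eval u) ≤ v u := by
  refine v.map_sum_le fun i _ ↦ ?_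
  rw [map_mul, map_pow]
  rcases eq_or_ne i 0 with rfl | hi
  · simpa using mul_le_of_le_one_left' h0
  · obtain ⟨m, hm⟩ := Nat.exists_eq_succ_of_ne_zero (card_pow_ne_zero (Fq := Fq) i)
    have := h i hi
    rw [hm, Nat.succ_sub_one] at this
    rw [hm, pow_succ, ← mul_assoc]
    exact mul_le_of_le_one_left' this

theorem InStableDisc.map_iterate_eval_le {u : L} (h : InStableDisc v p u)
    (h0 : v (algebraMap K L (p.coeff 0)) ≤ 1) (n : ℕ) : v (p.eval^[n] u) ≤ v u := by
  induction n with
  | zero => rfl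
  | succ n ih =>
    rw [Function.iterate_succ_apply']
    exact ((h.mono ih).map_eval_le h0).trans ih

/-- Discreteness of the valuation turns a strict inequality into a gap of 1, from which the
geometric growth starts. -/
theorem exists_of_not_inStableDisc {u : L} (h : ¬ InStableDisc v p u) :
    v u ≠ 0 ∧ ∃ i, i ≠ 0 ∧ p.coeff i ≠ 0 ∧
      1 ≤ log (v (algebraMap K L (p.coeff i))) +
        ((Fintype.card Fq ^ i - 1 : ℕ) : ℤ) * log (v u) := by
  have hu : v u ≠ 0 := fun hu ↦ h (inStableDisc_zero.mono (by simp [hu]))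
  simp only [InStableDisc, not_forall, not_le] at h
  obtain ⟨i, hi, hlt⟩ := h
  have ha : p.coeff i ≠ 0 := fun ha ↦ by simp [ha] at hlt
  refine ⟨hu, i, hi, ha, ?_⟩
  have hva := map_coeff_ne_zero v ha
  rw [← log_lt_log one_ne_zero (mul_ne_zero hva (pow_ne_zero _ hu)), log_one,
    log_mul hva (pow_ne_zero _ hu), log_pow, nsmul_eq_mul] at hlt
  exact hlt

/-- Iterates of a term of `p` that expands a disc grow geometrically. -/
theorem card_pow_le_log_iterate {i : ℕ} (hi : i ≠ 0) (ha : p.coeff i ≠ 0) {π : L} (hπ : π ≠ 0)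
    (h : 1 ≤ log (v (algebraMap K L (p.coeff i))) +
      ((Fintype.card Fq ^ i - 1 : ℕ) : ℤ) * log (v π)) (n : ℕ) :
    (fun z ↦ algebraMap K L (p.coeff i) * z ^ (Fintype.card Fq ^ i))^[n] π ≠ 0 ∧
    (Fintype.card Fq : ℤ) ^ n ≤ log (v (algebraMap K L (p.coeff i))) +
      ((Fintype.card Fq ^ i - 1 : ℕ) : ℤ) * log (v
        ((fun z ↦ algebraMap K L (p.coeff i) * z ^ (Fintype.card Fq ^ i))^[n] π)) := by
  have ha' : algebraMap K L (p.coeff i) ≠ 0 := by simpa using ha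
  have hva := map_coeff_ne_zero v ha
  induction n with
  | zero => exact ⟨hπ, by simpa using h⟩
  | succ n ih =>
    rw [Function.iterate_succ_apply']
    -- For f(z) = a z^Q with Q = q^i, the quantity log|a| + (Q − 1) log|z| = log|f(z)/z| is
    -- multiplied exactly by Q when z is replaced by f(z).
    set z := (fun z ↦ algebraMap K L (p.coeff i) * z ^ (Fintype.card Fq ^ i))^[n] π
    have hz : v z ≠ 0 := by simpa using ih.1
    refine ⟨mul_ne_zero ha' (pow_ne_zero _ ih.1), ?_⟩
    rw [map_mul, map_pow, log_mul hva (pow_ne_zero _ hz), log_pow, nsmul_eq_mul]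
    have h1 : (Fintype.card Fq : ℤ) ≤ (Fintype.card Fq ^ i : ℕ) :=
      mod_cast Nat.le_self_pow hi _
    have h2 : ((Fintype.card Fq ^ i - 1 : ℕ) : ℤ) = (Fintype.card Fq ^ i : ℕ) - 1 := by
      have := Nat.pos_of_ne_zero (card_pow_ne_zero (Fq := Fq) i)
      omega
    have h3 : (0 : ℤ) ≤ (Fintype.card Fq : ℤ) ^ n := by positivity
    have h4 : (0 : ℤ) ≤ (Fintype.card Fq ^ i : ℕ) := by positivity
    have h5 := ih.2
    rw [h2] at h5 ⊢
    rw [pow_succ]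
    generalize ((Fintype.card Fq ^ i : ℕ) : ℤ) = Q at *
    nlinarith [mul_le_mul h5 h1 (by positivity) (h3.trans h5)]

variable [Algebra Fq L]

theorem _root_.Valuation.map_smul_of_finite (v : Valuation L ℤᵐ⁰) {c : Fq} (hc : c ≠ 0) (x : L) :
    v (c • x) = v x := by
  refine (v.map_smul_le_of_finite c x).antisymm ?_
  simpa [smul_smul, inv_mul_cancel₀ hc] using v.map_smul_le_of_finite c⁻¹ (c • x)

theorem iterate_eval_sum_smul (p : TwistedPoly Fq K) (n : ℕ) {ι : Type*} (s : Finset ι)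
    (c : ι → Fq) (f : ι → L) : p.eval^[n] (∑ j ∈ s, c j • f j) = ∑ j ∈ s, c j • p.eval^[n] (f j) := by
  simp only [← eval_pow]
  rw [← evalLin_apply, map_sum]
  simp only [map_smul, evalLin_apply]

/-- Nontrivial `Fq`-linear combinations of the iterates of an escaping point stay outside the
stable disc. -/
theorem not_inStableDisc_of_escapeRate_pos (hp : p ≠ 0) (hD : 1 < p.deg)
    (h0 : v (algebraMap K L (p.coeff 0)) ≤ 1) {y : L} (hy : 0 < escapeRate v p y) {N : ℕ}
    {c : Fin N → Fq} (hc : c ≠ 0) :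
    ¬ InStableDisc v p (∑ j, c j • p.eval^[j] y) := by
  classical
  intro hdisc
  obtain ⟨Λ, hΛ⟩ := exists_coeffBound v p
  have hΛ0 : (0 : ℝ) ≤ Λ := mod_cast hΛ.nonneg hp
  set H := escapeRate v p y with hH
  have hD2 : (2 : ℝ) ≤ p.deg := mod_cast hD
  have hclose : ∀ n, |(p.deg : ℝ) ^ n * H - logPlus v (p.eval^[n] y)| ≤ 4 * Λ := fun n ↦ by
    rw [← escapeRate_iterate_of_commute v hp hD hp (Commute.refl p)]
    exact (hΛ.escapeRate_spec hp hD _).2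
  have hbig : Tendsto (fun n : ℕ ↦ (p.deg : ℝ) ^ n * H) atTop atTop :=
    (tendsto_pow_atTop_atTop_of_one_lt (by linarith)).atTop_mul_const hy
  set u := ∑ j, c j • p.eval^[j] y with hu
  -- The term 8Λ makes the sizes along the orbit strictly increase from n on, with 4Λ lost at each
  -- of two consecutive points; 4Λ + log⁺|u| contradicts boundedness of the orbit of `u`.
  obtain ⟨n, hn⟩ := (eventually_atTop.1
    (hbig.eventually_gt_atTop (8 * Λ + 4 * Λ + logPlus v u)))
  have hlog0 : (0 : ℝ) ≤ logPlus v u := mod_cast logPlus_nonneg v u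
  have hmono : ∀ m, n ≤ m → v (p.eval^[m] y) < v (p.eval^[m + 1] y) := fun m hm ↦ by
    by_contra! hle
    have h1 : (logPlus v (p.eval^[m + 1] y) : ℝ) ≤ logPlus v (p.eval^[m] y) :=
      mod_cast logPlus_le_logPlus hle
    have h2 := abs_le.1 (hclose m)
    have h3 := abs_le.1 (hclose (m + 1))
    have h4 := hn m hm
    rw [pow_succ] at h3
    nlinarith
  have hmono' : ∀ i j, i < j → v (p.eval^[n + i] y) < v (p.eval^[n + j] y) := by
    intro i j hij
    exact strictMono_nat_of_lt_succ (f := fun i ↦ v (p.eval^[n + i] y))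
      (fun i ↦ hmono _ (Nat.le_add_right n i)) hij
  have hne : (Finset.univ.filter fun j ↦ c j ≠ 0).Nonempty := by
    obtain ⟨j, hj⟩ := Function.ne_iff.1 hc
    exact ⟨j, by simpa using hj⟩
  obtain ⟨j₀, hj₀, hmax⟩ := Finset.exists_max_image _ id hne
  simp only [Finset.mem_filter, Finset.mem_univ, true_and, id] at hj₀ hmax
  -- Sizes strictly increase along the orbit, so the last term with nonzero coefficient dominates.
  have hval : v (p.eval^[n] u) = v (p.eval^[n + j₀] y) := by
    rw [hu, iterate_eval_sum_smul]
    simp only [← Function.iterate_add_apply]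
    rw [v.map_sum_eq_of_lt (Finset.mem_univ j₀), v.map_smul_of_finite hj₀]
    intro j hj
    rw [v.map_smul_of_finite hj₀]
    simp only [Finset.mem_sdiff, Finset.mem_univ, true_and, Finset.mem_singleton] at hj
    by_cases hcj : c j = 0
    · rw [hcj, zero_smul, map_zero]
      refine zero_lt_iff.2 fun hz ↦ ?_
      have h2 := abs_le.1 (hclose (n + j₀))
      have h4 := hn (n + j₀) (Nat.le_add_right _ _)
      rw [logPlus, hz] at h2
      simp only [log_zero, max_self, Int.cast_zero] at h2
      linarith
    · rw [v.map_smul_of_finite hcj]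
      exact hmono' j j₀ (lt_of_le_of_ne (hmax j hcj) (fun h ↦ hj (Fin.ext h)))
  have h1 : (logPlus v (p.eval^[n + j₀] y) : ℝ) ≤ logPlus v u := by
    rw [logPlus, ← hval]
    exact mod_cast logPlus_le_logPlus (hdisc.map_iterate_eval_le h0 n)
  have h2 := abs_le.1 (hclose (n + j₀))
  have h4 := hn (n + j₀) (Nat.le_add_right _ _)
  linarith

/-- A point with positive rate of escape becomes large after logarithmically many steps. -/
theorem exists_iterate_large (hv : Function.Surjective v) (hp : p ≠ 0) (hD : 1 < p.deg)
    (h0 : v (algebraMap K L (p.coeff 0)) ≤ 1) (hΛ : CoeffBound v p Λ) {y : L}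
    (hy : 0 < escapeRate v p y) (n : ℕ) :
    ∃ m ≤ (p.tauDeg + 1) * n,
      (Fintype.card Fq : ℤ) ^ n ≤ p.deg * logPlus v (p.eval^[m] y) + Λ := by
  have hΛ0 := hΛ.nonneg hp
  -- One more than the number of dimensions that can be lost in n steps.
  set N := p.tauDeg * n + 1
  let g : (Fin N → Fq) →ₗ[Fq] L := Fintype.linearCombination Fq fun j : Fin N ↦ p.eval^[j] y
  have hg : ∀ c : Fin N → Fq, g c = ∑ j, c j • p.eval^[j] y := fun c ↦
    Fintype.linearCombination_apply Fq _ c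
  have hgdisc : ∀ c : Fin N → Fq, c ≠ 0 → ¬ InStableDisc v p (g c) := fun c hc ↦ by
    rw [hg]
    exact not_inStableDisc_of_escapeRate_pos hp hD h0 hy hc
  have hginj : Function.Injective g := by
    refine LinearMap.ker_eq_bot.1 ((LinearMap.ker_eq_bot').2 fun c hc ↦ ?_)
    by_contra hne
    exact hgdisc c hne (hc ▸ inStableDisc_zero)
  -- The logarithmic radii at which some nonlinear term expands. They are integers bounded below by
  -- −Λ, so there is a least one `l`, and every nonzero element of the span has logarithmic size at
  -- least `l`.
  let P : ℤ → Prop := fun l ↦ ∃ i, i ≠ 0 ∧ p.coeff i ≠ 0 ∧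
    1 ≤ log (v (algebraMap K L (p.coeff i))) + ((Fintype.card Fq ^ i - 1 : ℕ) : ℤ) * l
  have hPbdd : ∀ l, P l → -Λ ≤ l := by
    rintro l ⟨i, hi, ha, hl⟩
    by_contra! hlt
    have h1 := abs_le.1 (hΛ i ha)
    have h2 : (1 : ℤ) ≤ ((Fintype.card Fq ^ i - 1 : ℕ) : ℤ) :=
      mod_cast Nat.sub_pos_of_lt (Nat.one_lt_pow hi Fintype.one_lt_card)
    nlinarith
  have hPg : ∀ c : Fin N → Fq, c ≠ 0 → P (log (v (g c))) := fun c hc ↦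
    (exists_of_not_inStableDisc (hgdisc c hc)).2
  obtain ⟨l, ⟨i, hi, ha, hl⟩, hlmin⟩ := Int.exists_least_of_bdd (P := P) ⟨-Λ, hPbdd⟩
    ⟨_, hPg 1 one_ne_zero⟩
  obtain ⟨π, hπ⟩ := hv (exp l)
  have hπ0 : π ≠ 0 := by
    rintro rfl
    rw [map_zero] at hπ
    exact exp_ne_zero hπ.symm
  obtain ⟨_, ⟨c, rfl⟩, hc⟩ := exists_le_iterate_eval v ha n π hπ0 (LinearMap.range g) (by
    rintro _ ⟨c, rfl⟩ hne
    have hc : c ≠ 0 := by rintro rfl; exact hne (map_zero g)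
    rw [hπ, ← le_log_iff_exp_le (by simpa using hne)]
    exact hlmin _ (hPg c hc)) (by
    rw [LinearMap.finrank_range_of_inj hginj, Module.finrank_fintype_fun_eq_card,
      Fintype.card_fin]
    exact Nat.lt_succ_self _)
  have hgrow := card_pow_le_log_iterate hi ha hπ0 (v := v) (by rw [hπ, log_exp]; exact hl) n
  set z := (fun z ↦ algebraMap K L (p.coeff i) * z ^ (Fintype.card Fq ^ i))^[n] π
  have hz : v z ≠ 0 := by simpa using hgrow.1
  -- By the ultrametric inequality a combination is no larger than its largest term.
  have hexists : ∃ j : Fin N, v z ≤ v (p.eval^[n + j] y) := by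
    by_contra! hlt
    refine hc.not_gt ?_
    rw [hg, iterate_eval_sum_smul]
    refine v.map_sum_lt hz fun j _ ↦ (v.map_smul_le_of_finite _ _).trans_lt ?_
    rw [← Function.iterate_add_apply]
    exact hlt j
  obtain ⟨j, hj⟩ := hexists
  refine ⟨n + j, ?_, ?_⟩
  · have := Nat.lt_succ_iff.1 j.2
    rw [add_mul, one_mul]
    omega
  · have h1 := abs_le.1 (hΛ i ha)
    have h2 : log (v z) ≤ logPlus v (p.eval^[n + j] y) :=
      (le_max_right _ _).trans (logPlus_le_logPlus hj)
    have h3 := logPlus_nonneg v (p.eval^[n + j] y)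
    have h4 : ((Fintype.card Fq ^ i - 1 : ℕ) : ℤ) ≤ p.deg := by
      exact_mod_cast (Nat.sub_le _ _).trans (card_pow_le_deg ha)
    have h5 : (0 : ℤ) ≤ ((Fintype.card Fq ^ i - 1 : ℕ) : ℤ) := by positivity
    have h6 := mul_le_mul_of_nonneg_left h2 h5
    have h7 := mul_le_mul_of_nonneg_right h4 h3
    linarith [hgrow.2]

/-- A lower bound for positive rates of escape that is polynomial in the size of the
coefficients. -/
theorem le_escapeRate (hv : Function.Surjective v) (hp : p ≠ 0) (hD : 1 < p.deg)
    (h0 : v (algebraMap K L (p.coeff 0)) ≤ 1) (hΛ : CoeffBound v p Λ) (hΛ1 : 1 ≤ Λ) {y : L}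
    (hy : 0 < escapeRate v p y) :
    (Λ : ℝ) / (7 * Fintype.card Fq * p.deg * Λ) ^ (p.tauDeg * (p.tauDeg + 1)) ≤
      escapeRate v p y := by
  set q := Fintype.card Fq with hq
  have hq1 : (1 : ℤ) < q := mod_cast Fintype.one_lt_card
  have hD1 : (1 : ℤ) < p.deg := mod_cast hD
  -- From q^n ≥ 7DΛ one gets D log⁺ ≥ 7DΛ − Λ ≥ 6DΛ, and 6Λ exceeds the error 4Λ of the escape rate.
  -- Taking the least such n costs only a factor q.
  have hex : ∃ n : ℕ, 7 * p.deg * Λ ≤ (q : ℤ) ^ n := by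
    obtain ⟨n, hn⟩ := pow_unbounded_of_one_lt (7 * p.deg * Λ) hq1
    exact ⟨n, hn.le⟩
  classical
  obtain ⟨n, hn, hmin⟩ : ∃ n : ℕ, 7 * p.deg * Λ ≤ (q : ℤ) ^ n ∧ (q : ℤ) ^ n ≤ 7 * q * p.deg * Λ := by
    refine ⟨Nat.find hex, Nat.find_spec hex, ?_⟩
    obtain hn | ⟨k, hk⟩ : Nat.find hex = 0 ∨ ∃ k, Nat.find hex = k + 1 := by
      cases Nat.find hex with
      | zero => exact Or.inl rfl
      | succ k => exact Or.inr ⟨k, rfl⟩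
    · have := Nat.find_spec hex
      rw [hn] at this
      nlinarith
    · have := Nat.find_min hex (m := k) (by omega)
      rw [hk, pow_succ]
      nlinarith
  obtain ⟨m, hm, hlarge⟩ := exists_iterate_large hv hp hD h0 hΛ hy n
  have hlog : 6 * Λ ≤ logPlus v (p.eval^[m] y) := by
    by_contra! hlt
    nlinarith
  have hspec := abs_le.1 (hΛ.escapeRate_spec hp hD (p.eval^[m] y)).2
  rw [escapeRate_iterate_of_commute v hp hD hp (Commute.refl p)] at hspec
  have hΛr : (1 : ℝ) ≤ Λ := mod_cast hΛ1
  have hlog' : 6 * (Λ : ℝ) ≤ logPlus v (p.eval^[m] y) := mod_cast hlog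
  have hDr : (1 : ℝ) < p.deg := mod_cast hD
  have hmain : (Λ : ℝ) ≤ p.deg ^ m * escapeRate v p y := by linarith [hspec.1]
  -- Since D = q^r and m ≤ (r+1)n, D^m is at most (q^n)^(r(r+1)).
  have hpow : (p.deg : ℝ) ^ m ≤
      (7 * q * p.deg * Λ) ^ (p.tauDeg * (p.tauDeg + 1)) := by
    calc (p.deg : ℝ) ^ m ≤ (p.deg : ℝ) ^ ((p.tauDeg + 1) * n) :=
          pow_le_pow_right₀ hDr.le hm
      _ = ((q : ℝ) ^ n) ^ (p.tauDeg * (p.tauDeg + 1)) := by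
          rw [deg_eq, Nat.cast_pow, ← pow_mul, ← pow_mul]
          congr 1
          ring
      _ ≤ _ := pow_le_pow_left₀ (by positivity) (mod_cast hmin) _
  rw [div_le_iff₀ (by positivity), mul_comm]
  exact hmain.trans (mul_le_mul_of_nonneg_right hpow hy.le)

end TwistedPoly
end LocalLehmer

/-! ### Places away from ∞, ramification, integrality of the degree -/

namespace LocalLehmer
open WithZero Filter Topology

section Infinity

variable {F L : Type*} [Field F] [Field L] {infty : ValuationSubring F}

/-- A place of `L` that does not lie over `∞` is nonnegative on `A`. -/
theorem map_le_one_of_not_liesOverInfinity {i : regularAway infty →+* L}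
    (hi : Function.Injective i) {v : Valuation L ℤᵐ⁰} (hv : ¬ LiesOverInfinity infty i v)
    (a : regularAway infty) : v (i a) ≤ 1 := by
  by_contra! hlt
  refine hv ?_
  let A := regularAway infty
  let Q := FractionRing A
  let fF : Q →+* F := IsFractionRing.lift (g := A.subtype) Subtype.val_injective
  let fL : Q →+* L := IsFractionRing.lift hi
  have hfF : ∀ x : A, fF (algebraMap A Q x) = x := fun x ↦ IsFractionRing.lift_algebraMap _ x
  have hfL : ∀ x : A, fL (algebraMap A Q x) = i x := fun x ↦ IsFractionRing.lift_algebraMap hi x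
  -- The restriction of `v` to Frac(A) is extended to a valuation ring `B` of `F`. As a ∉ B, the
  -- ring A is not contained in `B`, which by the definition of A forces `B = infty`.
  obtain ⟨B, hB⟩ := exists_valuationSubring_mem_iff fF (v.comap fL).valuationSubring
  have hB' : ∀ x, fF x ∈ B ↔ v (fL x) ≤ 1 := fun x ↦ hB x
  have haB : (a : F) ∉ B := by
    rw [← hfF, hB', hfL, not_le]
    exact hlt
  have hBinfty : B = infty := by
    by_contra hne
    have hBtop : B ≠ ⊤ := by
      rintro rfl
      exact haB (ValuationSubring.mem_top _)
    have hle : regularAway infty ≤ B.toSubring := iInf_le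
      (fun O : {O : ValuationSubring F // O ≠ ⊤ ∧ O ≠ infty} ↦ O.1.toSubring) ⟨B, hBtop, hne⟩
    exact haB (hle a.2)
  intro x y _
  have hmem : ∀ z, z ∈ infty ↔ z ∈ B := fun z ↦ by rw [hBinfty]
  rw [hmem, ← hfF, ← hfF, ← map_div₀, hB', map_div₀, hfL, hfL]

end Infinity

section Ramification

variable {K L : Type*} [Field K] [Field L] [Algebra K L]

/-- A surjective valuation below `v` has a positive ramification index, and the restriction of `v`
is the corresponding power. -/
theorem ramificationIndex_spec {v₀ : Valuation K ℤᵐ⁰} {v : Valuation L ℤᵐ⁰} [v₀.HasExtension v]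
    (h₀ : Function.Surjective v₀) :
    1 ≤ ramificationIndex v₀ v ∧
      ∀ y : K, v (algebraMap K L y) = v₀ y ^ ramificationIndex v₀ v := by
  obtain ⟨π, hπ⟩ := h₀ (exp (-1))
  have hπ0 : π ≠ 0 := by
    rintro rfl
    rw [map_zero] at hπ
    exact exp_ne_zero hπ.symm
  have hvπ0 : v (algebraMap K L π) ≠ 0 := by simpa using hπ0
  have hlt : v (algebraMap K L π) < 1 := by
    have := Valuation.HasExtension.val_map_lt_iff v₀ v π 1
    rw [map_one, map_one, map_one] at this
    rw [this, hπ, ← exp_zero, exp_lt_exp]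
    norm_num
  have hneg : log (v (algebraMap K L π)) < 0 := by
    rwa [← log_one (M := ℤ), log_lt_log hvπ0 one_ne_zero]
  obtain ⟨e, he⟩ := Int.eq_ofNat_of_zero_le (a := -log (v (algebraMap K L π))) (by omega)
  have he' : v (algebraMap K L π) = exp (-(e : ℤ)) := by rw [← he, neg_neg, exp_log hvπ0]
  have hpow : ∀ y : K, v (algebraMap K L y) = v₀ y ^ e := by
    intro y
    rcases eq_or_ne y 0 with rfl | hy
    · have : e ≠ 0 := by omega
      simp [this]
    · have hy0 : v₀ y ≠ 0 := by simpa using hy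
      set n := log (v₀ y)
      -- Multiplying by a power of the uniformizer makes y a unit at `v₀`, hence at `v`.
      have h1 : v₀ (y * π ^ n) = 1 := by
        rw [map_mul, map_zpow₀, hπ, ← exp_log hy0, ← exp_zsmul, ← exp_add]
        simp [n]
      have h2 : v (algebraMap K L (y * π ^ n)) = 1 := by
        have := Valuation.HasExtension.val_map_le_iff v₀ v (y * π ^ n) 1
        have h3 := Valuation.HasExtension.val_map_le_iff v₀ v 1 (y * π ^ n)
        rw [h1, map_one, map_one, map_one] at this h3
        exact le_antisymm (this.2 le_rfl) (h3.2 le_rfl)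
      rw [map_mul, map_zpow₀, map_mul, map_zpow₀, he', ← exp_zsmul] at h2
      rw [eq_comm, ← exp_log hy0, ← exp_nsmul, eq_inv_of_mul_eq_one_left h2, ← exp_neg]
      congr 1
      simp [n]
      ring
  have hmem : ramificationIndex v₀ v ∈ {e : ℕ | ∀ y : K, v (algebraMap K L y) = v₀ y ^ e} :=
    Nat.sInf_mem ⟨e, hpow⟩
  refine ⟨Nat.one_le_iff_ne_zero.2 fun h ↦ ?_, hmem⟩
  have := hmem π
  rw [h, pow_zero] at this
  exact hlt.ne this

/-- Normalized valuations with the same valuation ring are equal. -/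
theorem eq_of_surjective_of_le_one_iff {v w : Valuation K ℤᵐ⁰} (hv : Function.Surjective v)
    (hw : Function.Surjective w) (h : ∀ y, v y ≤ 1 ↔ w y ≤ 1) : v = w := by
  -- `w` is regarded as an extension of `v` along K/K; surjectivity of `w` then forces ramification
  -- index 1.
  have hvw : v.IsEquiv (w.comap (algebraMap K K)) :=
    Valuation.isEquiv_iff_val_le_one.2 fun {y} ↦ h y
  have : v.HasExtension w := ⟨hvw⟩
  obtain ⟨he, hpow⟩ := ramificationIndex_spec (v := w) hv
  set e := ramificationIndex v w
  obtain ⟨y, hy⟩ := hw (exp 1)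
  have h1 : w y = v y ^ e := hpow y
  have hvy : v y ≠ 0 := fun h0 ↦ by
    rw [hy, h0, zero_pow (by omega)] at h1
    exact exp_ne_zero h1
  have h2 := congrArg log h1
  rw [hy, log_exp, log_pow, nsmul_eq_mul] at h2
  have he1 : (e : ℤ) = 1 := by
    have := Int.isUnit_iff.1 (IsUnit.of_mul_eq_one _ h2.symm)
    omega
  ext y
  have := hpow y
  rw [show e = 1 by exact_mod_cast he1, pow_one] at this
  exact this.symm

end Ramification

section Degree

open Polynomial

/-- The normalized leading coefficient of a polynomial that takes integral values at all large
natural numbers is integral. -/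
theorem exists_int_eq_factorial_mul_leadingCoeff (p : ℚ[X]) {f : ℕ → ℕ}
    (h : ∀ᶠ n : ℕ in atTop, (f n : ℚ) = p.eval (n : ℚ)) :
    ∃ z : ℤ, (p.natDegree.factorial : ℚ) * p.leadingCoeff = z := by
  obtain ⟨n₀, hn₀⟩ := eventually_atTop.1 h
  -- The d-th finite difference of a polynomial of degree d is the constant d! times its leading
  -- coefficient, and it is an integral combination of values.
  have h1 := congrFun p.fwdDiff_iter_degree_eq_factorial (n₀ : ℚ)
  rw [fwdDiff_iter_eq_sum_shift] at h1
  refine ⟨∑ k ∈ Finset.range (p.natDegree + 1),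
    ((-1 : ℤ) ^ (p.natDegree - k) * p.natDegree.choose k) * f (n₀ + k), ?_⟩
  have h2 : (p.natDegree.factorial : ℚ) * p.leadingCoeff =
      (p.leadingCoeff • (p.natDegree.factorial : ℚ → ℚ)) (n₀ : ℚ) := by
    simp [mul_comm]
  rw [h2, ← h1, Int.cast_sum]
  refine Finset.sum_congr rfl fun k _ ↦ ?_
  have h3 := hn₀ (n₀ + k) (Nat.le_add_right _ _)
  rw [zsmul_eq_mul, Int.cast_mul _ (f (n₀ + k) : ℤ), Int.cast_natCast, h3]
  simp

theorem ProjectiveModel.one_le_degree {Fq K : Type*} [Field Fq] [Field K] [Algebra Fq K]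
    (V : ProjectiveModel Fq K) {v : Valuation K ℤᵐ⁰} (h : 0 < V.degree v) : 1 ≤ V.degree v := by
  unfold ProjectiveModel.degree at h ⊢
  split_ifs at h ⊢ with hp
  · obtain ⟨z, hz⟩ := exists_int_eq_factorial_mul_leadingCoeff _ hp.choose_spec
    rw [hz] at h ⊢
    exact_mod_cast h
  · exact absurd h (lt_irrefl _)

end Degree

end LocalLehmer

/-! ### Finiteness of zeros and poles on the projective model -/

namespace LocalLehmer
open WithZero Filter Topology

theorem mem_minimalPrimes_span_singleton {R : Type*} [CommRing R] [IsDomain R] {P : Ideal R}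
    [P.IsPrime] (hP : P.height = 1) {x : R} (hx : x ≠ 0) (hxP : x ∈ P) :
    P ∈ (Ideal.span {x}).minimalPrimes := by
  have : P.FiniteHeight := ⟨Or.inr (by rw [hP]; exact ENat.one_ne_top)⟩
  refine Ideal.mem_minimalPrimes_of_height_le ((Ideal.span_singleton_le_iff_mem _).2 hxP) ?_
  rw [hP]
  exact Ideal.one_le_height_span_singleton_of_mem_nonZeroDivisors (mem_nonZeroDivisors_of_ne_zero hx)

namespace ProjectiveModel

variable {Fq K : Type*} [Field Fq] [Field K] [Algebra Fq K] (V : ProjectiveModel Fq K)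

instance (j : Fin (V.M + 1)) : IsNoetherianRing (V.chart j) := by
  have : Algebra.FiniteType V.k (V.chart j) :=
    Algebra.FiniteType.adjoin_of_finite (Set.finite_range _)
  exact Algebra.FiniteType.isNoetherianRing V.k (V.chart j)

theorem exists_eq_div {j : Fin (V.M + 1)} (hj : V.coord j ≠ 0) (a : K) :
    ∃ b c : V.chart j, a = (b : K) / (c : K) := by
  have ha : a ∈ IntermediateField.adjoin V.k (Set.range fun l ↦ V.coord l / V.coord j) := by
    rw [V.adjoin_eq_top j hj]
    trivial
  obtain ⟨b, hb, c, hc, h⟩ := IntermediateField.mem_adjoin_iff_div.1 ha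
  exact ⟨⟨b, hb⟩, ⟨c, hc⟩, h⟩

theorem isFractionRing_chart {j : Fin (V.M + 1)} (hj : V.coord j ≠ 0) :
    IsFractionRing (V.chart j) K :=
  IsFractionRing.of_field _ _ fun a ↦ by
    obtain ⟨b, c, h⟩ := V.exists_eq_div hj a
    exact ⟨b, c, h⟩

/-- By normality the chart is its own integral closure in `K`. -/
theorem isNoetherianRing_integralClosure {j : Fin (V.M + 1)} (hj : V.coord j ≠ 0) :
    IsNoetherianRing (integralClosure (V.chart j) K) := by
  have := V.isFractionRing_chart hj
  have : IsIntegrallyClosed (V.chart j) := V.normal j hj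
  refine isNoetherianRing_of_surjective (V.chart j) _
    (algebraMap (V.chart j) (integralClosure (V.chart j) K)) fun x ↦ ?_
  obtain ⟨y, hy⟩ := IsIntegrallyClosed.algebraMap_eq_of_integral x.2
  exact ⟨y, Subtype.ext hy⟩

/-- A nonzero function has finitely many zeros and poles. -/
theorem finite_divisors_map_ne_one {a : K} (ha : a ≠ 0) :
    {v ∈ V.divisors K | v a ≠ 1}.Finite := by
  let att (j : Fin (V.M + 1)) (P : Ideal (integralClosure (V.chart j) K)) :
      Set (Valuation K ℤᵐ⁰) := {v | Function.Surjective v ∧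
        ∀ y : K, v y ≤ 1 ↔ ∃ a b : integralClosure (V.chart j) K, b ∉ P ∧ y = (a : K) / (b : K)}
  -- A prime determines the valuation ring, and hence the normalized valuation.
  have hatt : ∀ j P, (att j P).Finite := fun j P ↦ Set.Subsingleton.finite fun v hv w hw ↦
    eq_of_surjective_of_le_one_iff hv.1 hw.1 fun y ↦ (hv.2 y).trans (hw.2 y).symm
  have hchart : ∀ j, ∃ T : Set (Valuation K ℤᵐ⁰), T.Finite ∧ (V.coord j ≠ 0 →
      ∀ P : Ideal (integralClosure (V.chart j) K), P.IsPrime → P.height = 1 →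
        ∀ v ∈ att j P, v a ≠ 1 → v ∈ T) := by
    intro j
    by_cases hj : V.coord j ≠ 0
    swap
    · exact ⟨∅, Set.finite_empty, fun h ↦ absurd h hj⟩
    have := V.isNoetherianRing_integralClosure hj
    obtain ⟨b, c, habc⟩ := V.exists_eq_div hj a
    set R := integralClosure (V.chart j) K
    let b' : R := algebraMap (V.chart j) R b
    let c' : R := algebraMap (V.chart j) R c
    have habc' : a = (b' : K) / (c' : K) := habc
    have hb0 : b' ≠ 0 := fun h ↦ ha (by rw [habc', h]; simp)
    have hc0 : c' ≠ 0 := fun h ↦ ha (by rw [habc', h]; simp)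
    refine ⟨⋃ P ∈ (Ideal.span {b' * c'}).minimalPrimes, att j P,
      (Ideal.finite_minimalPrimes_of_isNoetherianRing R _).biUnion fun P _ ↦ hatt j P,
      fun _ P hP hht v hv hva ↦ Set.mem_biUnion (x := P) ?_ hv⟩
    -- Otherwise both a and its inverse lie in the local ring at P. So P contains bc, and having
    -- height one it is among the finitely many minimal primes over (bc).
    have hmem : b' * c' ∈ P := by
      by_contra hbc
      have hb : b' ∉ P := fun h ↦ hbc (P.mul_mem_right _ h)
      have hc : c' ∉ P := fun h ↦ hbc (P.mul_mem_left _ h)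
      refine hva (le_antisymm ((hv.2 a).2 ⟨b', c', hc, habc'⟩) ?_)
      have h1 : v a⁻¹ ≤ 1 := (hv.2 a⁻¹).2 ⟨c', b', hb, by rw [habc', inv_div]⟩
      rw [map_inv₀] at h1
      exact (inv_le_one₀ (zero_lt_iff.2 (by simpa using ha))).1 h1
    exact mem_minimalPrimes_span_singleton hht (mul_ne_zero hb0 hc0) hmem
  choose T hT hTmem using hchart
  refine (Set.finite_iUnion hT).subset ?_
  rintro v ⟨⟨hsurj, j, hj, P, hP, hht, hv⟩, hva⟩
  exact Set.mem_iUnion.2 ⟨j, hTmem j hj P hP hht v ⟨hsurj, hv⟩ hva⟩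

theorem exists_abs_log_le (a : K) : ∃ B : ℤ, ∀ v ∈ V.divisors K, |log (v a)| ≤ B := by
  rcases eq_or_ne a 0 with rfl | ha
  · exact ⟨0, fun v _ ↦ by simp⟩
  obtain ⟨B, hB⟩ := ((V.finite_divisors_map_ne_one ha).image fun v ↦ |log (v a)|).bddAbove
  refine ⟨max B 0, fun v hv ↦ ?_⟩
  by_cases h : v a = 1
  · simp [h]
  · exact le_max_of_le_left (hB ⟨v, ⟨hv, h⟩, rfl⟩)

end ProjectiveModel
end LocalLehmer

/-! ### Local heights of Drinfeld modules -/

namespace LocalLehmer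
open WithZero Filter Topology TwistedPoly

namespace DrinfeldModule

variable {Fq A K L : Type*} [Field Fq] [Fintype Fq] [CommRing A] [Field K] [Algebra Fq K]
  [Field L] [Algebra K L] (φ : DrinfeldModule Fq A K)

variable {φ} in
theorem IsGeneric.injective (hφ : φ.IsGeneric) : Function.Injective φ.i :=
  (RingHom.injective_iff_ker_eq_bot _).2 hφ

variable {φ} in
theorem IsGeneric.toHom_ne_zero (hφ : φ.IsGeneric) {a : A} (ha : a ≠ 0) : φ.toHom a ≠ 0 := by
  intro h
  refine ha (hφ.injective ?_)
  rw [← φ.coeff_zero, h, map_zero]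
  rfl

theorem commute_toHom (a b : A) : Commute (φ.toHom a) (φ.toHom b) :=
  (Commute.all a b).map φ.toHom

/-- A positive local height is at least the rate of escape divided by the degree. -/
theorem div_le_localHeight {V : ProjectiveModel Fq K} {a : A} {v₀ : Valuation K ℤᵐ⁰}
    {v : Valuation L ℤᵐ⁰} [v₀.HasExtension v] {x : L} {H : ℝ} (hH : limitHeight φ a v x = -H)
    (hH0 : 0 ≤ H) (hpos : 0 < localHeight V φ a v₀ v x) :
    0 < H ∧ H / Module.finrank K L ≤ localHeight V φ a v₀ v x := by
  unfold localHeight at hpos ⊢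
  rw [hH, neg_mul_neg] at hpos ⊢
  have hHpos : 0 < H := hH0.lt_of_ne (by rintro rfl; simp at hpos)
  refine ⟨hHpos, ?_⟩
  have h1 := pos_of_mul_pos_left hpos hH0
  -- If `finrank` or `degree` took its default value 0, the height would vanish; so positivity makes
  -- the two degrees and the residue degree positive integers.
  have hd : (0 : ℝ) < Module.finrank K L := by
    rcases Nat.eq_zero_or_pos (Module.finrank K L) with h | h
    · simp [h] at h1
    · exact_mod_cast h
  rw [div_pos_iff_of_pos_right hd] at h1
  have hf : (1 : ℝ) ≤ residueDegree v₀ v := by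
    rcases Nat.eq_zero_or_pos (residueDegree v₀ v) with h | h
    · simp [h] at h1
    · exact_mod_cast h
  have hdeg : (0 : ℝ) < V.degree v₀ := pos_of_mul_pos_left h1 (by linarith)
  have hdeg1 : (1 : ℝ) ≤ V.degree v₀ := mod_cast V.one_le_degree (mod_cast hdeg)
  rw [div_mul_eq_mul_div]
  gcongr
  have h2 : (1 : ℝ) ≤ V.degree v₀ * residueDegree v₀ v := by nlinarith
  nlinarith

variable [Algebra Fq L]

theorem limitHeight_eq_neg_limUnder (v : Valuation L ℤᵐ⁰) {a : A} (ha : φ.toHom a ≠ 0) (x : L) :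
    limitHeight φ a v x = limUnder atTop fun n : ℕ ↦
      -((logPlus v ((φ.toHom a).eval^[n] x) : ℝ) / (φ.toHom a).deg ^ n) := by
  unfold limitHeight
  congr 1
  ext n
  rw [map_pow, eval_pow, deg_pow ha, truncOrd_eq_neg_logPlus]
  push_cast
  ring

theorem limitHeight_eq_neg_escapeRate (v : Valuation L ℤᵐ⁰) {a : A} (ha : φ.toHom a ≠ 0)
    (hD : 1 < (φ.toHom a).deg) (x : L) : limitHeight φ a v x = -escapeRate v (φ.toHom a) x := by
  rw [φ.limitHeight_eq_neg_limUnder v ha]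
  exact (tendsto_escapeRate v ha hD x).neg.limUnder_eq

/-- If `φ_a` is a constant that is integral at `v`, the limit is an integer. -/
theorem exists_nat_limitHeight_eq (v : Valuation L ℤᵐ⁰) {a : A} (ha : φ.toHom a ≠ 0)
    (hr : (φ.toHom a).tauDeg = 0) (hv : v (algebraMap K L (φ.i a)) ≤ 1) (x : L) :
    ∃ m : ℕ, limitHeight φ a v x = -(m : ℝ) := by
  set p := φ.toHom a
  have hdeg : p.deg = 1 := by rw [deg_eq, hr, pow_zero]
  -- Here p is multiplication by an integral constant, so log⁺ along the orbit is a nonincreasing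
  -- sequence of nonnegative integers, and the normalizing degrees are all 1.
  have hanti : Antitone fun n ↦ logPlus v (p.eval^[n] x) := antitone_nat_of_succ_le fun n ↦ by
    rw [Function.iterate_succ_apply']
    refine logPlus_le_logPlus ?_
    rw [eval_of_tauDeg_eq_zero hr, φ.coeff_zero, map_mul]
    exact mul_le_of_le_one_left' hv
  have hlim := tendsto_atTop_ciInf hanti ⟨0, by rintro _ ⟨n, rfl⟩; exact logPlus_nonneg v _⟩
  obtain ⟨m, hm⟩ := Int.eq_ofNat_of_zero_le (ge_of_tendsto' hlim fun n ↦ logPlus_nonneg v _)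
  rw [hm] at hlim
  refine ⟨m, ?_⟩
  rw [φ.limitHeight_eq_neg_limUnder v ha, hdeg]
  simp only [Nat.cast_one, one_pow, div_one]
  refine Tendsto.limUnder_eq (Tendsto.neg ?_)
  have h1 : Continuous fun z : ℤ ↦ (z : ℝ) := continuous_of_discreteTopology
  simpa [Function.comp_def] using (h1.tendsto (m : ℤ)).comp hlim

end DrinfeldModule

/-- In generic characteristic, either `φ_t` has positive degree in `τ` for all nonconstant `t`, or
for none. -/
theorem DrinfeldModule.IsGeneric.tauDeg_eq_zero {Fq F K : Type*} [Field Fq] [Fintype Fq]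
    [Field K] [Algebra Fq K] [Field F] [Algebra Fq F] {S : Subring F}
    {φ : DrinfeldModule Fq S K} (hφ : φ.IsGeneric) {t s : S} (ht : Transcendental Fq (t : F))
    (h : (φ.toHom t).tauDeg = 0) : (φ.toHom s).tauDeg = 0 := by
  refine tauDeg_eq_zero_of_commute (φ.commute_toHom t s) h fun n hn heq ↦ ht ?_
  -- By injectivity of `φ.i`, t itself would be a root of X^(q^n) − X, hence algebraic.
  rw [φ.coeff_zero, ← map_pow] at heq
  have h1 : (t : F) ^ (Fintype.card Fq ^ n) = t := congrArg Subtype.val (hφ.injective heq)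
  refine ⟨(Polynomial.X ^ (Fintype.card Fq ^ n) - Polynomial.X : Fq[X]),
    FiniteField.X_pow_card_pow_sub_X_ne_zero Fq hn Fintype.one_lt_card, ?_⟩
  simp [h1]


theorem TwistedPoly.exists_forall_coeffBound {Fq K : Type*} [Field Fq] [Fintype Fq] [Field K]
    [Algebra Fq K] (V : ProjectiveModel Fq K) (p : TwistedPoly Fq K) :
    ∃ B : ℤ, 1 ≤ B ∧ ∀ v ∈ V.divisors K, CoeffBound v p B := by
  choose b hb using V.exists_abs_log_le
  refine ⟨1 + ∑ i ∈ p.support, |b (p.coeff i)|,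
    le_add_of_nonneg_right (Finset.sum_nonneg fun _ _ ↦ abs_nonneg _), fun v hv i hi ↦ ?_⟩
  have h1 := Finset.single_le_sum (f := fun i ↦ |b (p.coeff i)|) (fun _ _ ↦ abs_nonneg _)
    (mem_support.2 hi)
  have h2 := hb (p.coeff i) v hv
  have h3 := le_abs_self (b (p.coeff i))
  simp only [Algebra.algebraMap_self, RingHom.id_apply]
  linarith

/-- The size of the coefficients is multiplied by the ramification index in an extension. -/
theorem TwistedPoly.CoeffBound.extension {Fq K L : Type*} [Field Fq] [Fintype Fq] [Field K]
    [Algebra Fq K] [Field L] [Algebra K L] {v₀ : Valuation K ℤᵐ⁰} {v : Valuation L ℤᵐ⁰}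
    [v₀.HasExtension v] (h₀ : Function.Surjective v₀) {p : TwistedPoly Fq K} {B : ℤ}
    (h : CoeffBound v₀ p B) : CoeffBound v p (ramificationIndex v₀ v * B) := by
  intro i hi
  rw [(ramificationIndex_spec (v := v) h₀).2, log_pow, nsmul_eq_mul, abs_mul, Nat.abs_cast]
  exact mul_le_mul_of_nonneg_left (h i hi) (by positivity)

end LocalLehmer
end

/-! ### The theorem -/

open LocalLehmer
theorem theoremT {Fq F K : Type*} [Field Fq] [Fintype Fq] [Field F] [Algebra Fq F]
    [Field K] [Algebra Fq K]
    (hF : (⊤ : IntermediateField Fq F).FG) (hF1 : Algebra.trdeg Fq F = 1)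
    (infty : ValuationSubring F) (hinfty : infty ≠ ⊤)
    (V : ProjectiveModel Fq K)
    (φ : DrinfeldModule Fq (regularAway infty) K) (hφ : φ.IsGeneric) :
    ∃ C k : ℝ, 0 < C ∧ 0 < k ∧
      ∀ t : regularAway infty, Transcendental Fq (t : F) →
      ∀ (x : AlgebraicClosure K) (v₀ : Valuation K ℤᵐ⁰) (v : Valuation K⟮x⟯ ℤᵐ⁰)
        [v₀.HasExtension v],
        v₀ ∈ V.divisors K → v ∈ V.divisors K⟮x⟯ →
        ¬ LiesOverInfinity infty ((algebraMap K K⟮x⟯).comp φ.i) v →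
        0 < localHeight V φ t v₀ v (AdjoinSimple.gen K x) →
        C / ((ramificationIndex v₀ v : ℝ) ^ (k - 1) * (Module.finrank K K⟮x⟯ : ℝ)) ≤
          localHeight V φ t v₀ v (AdjoinSimple.gen K x) := by
  have hne : ∀ t : regularAway infty, Transcendental Fq (t : F) → φ.toHom t ≠ 0 := fun t ht ↦
    hφ.toHom_ne_zero fun h ↦ ht (by rw [h]; exact isAlgebraic_zero)
  have hint : ∀ (x : AlgebraicClosure K) (v : Valuation K⟮x⟯ ℤᵐ⁰),
      ¬ LiesOverInfinity infty ((algebraMap K K⟮x⟯).comp φ.i) v →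
      ∀ t, v (algebraMap K K⟮x⟯ (φ.i t)) ≤ 1 := fun x v hv t ↦
    map_le_one_of_not_liesOverInfinity
      ((algebraMap K K⟮x⟯).injective.comp hφ.injective) hv t
  by_cases hconst : ∀ t : regularAway infty, Transcendental Fq (t : F) → (φ.toHom t).tauDeg = 0
  -- Degenerate case: the limit is −m with m a natural number, and a positive height forces m ≥ 1.
  · refine ⟨1, 1, one_pos, one_pos, fun t ht x v₀ v _ _ _ hv hpos ↦ ?_⟩
    obtain ⟨m, hm⟩ := φ.exists_nat_limitHeight_eq v (hne t ht) (hconst t ht) (hint x v hv t)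
      (AdjoinSimple.gen K x)
    obtain ⟨hm0, hle⟩ := φ.div_le_localHeight hm m.cast_nonneg hpos
    rw [sub_self, Real.rpow_zero, one_mul]
    refine le_trans ?_ hle
    gcongr
    exact_mod_cast hm0
  · push Not at hconst
    obtain ⟨t₀, ht₀, hr⟩ := hconst
    set p := φ.toHom t₀ with hp
    have hp0 : p ≠ 0 := hne t₀ ht₀
    have hdeg : ∀ s : TwistedPoly Fq K, s.tauDeg ≠ 0 → 1 < s.deg := fun s hs ↦
      Nat.one_lt_pow hs Fintype.one_lt_card
    obtain ⟨B, hB1, hB⟩ := TwistedPoly.exists_forall_coeffBound V p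
    have hBpos : (0 : ℝ) < B := mod_cast hB1
    have hqpos : (0 : ℝ) < Fintype.card Fq := mod_cast Fintype.card_pos
    have hDpos : (0 : ℝ) < p.deg := mod_cast p.deg_pos
    set k := p.tauDeg * (p.tauDeg + 1) with hk
    refine ⟨B / (7 * Fintype.card Fq * p.deg * B) ^ k, k, by positivity,
      mod_cast Nat.mul_pos (Nat.pos_of_ne_zero hr) (Nat.succ_pos _),
      fun t ht x v₀ v _ hv₀ hvL hv hpos ↦ ?_⟩
    have hDt : 1 < (φ.toHom t).deg := hdeg _ fun h ↦ hr (hφ.tauDeg_eq_zero ht h)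
    have hH := φ.limitHeight_eq_neg_escapeRate v (hne t ht) hDt (AdjoinSimple.gen K x)
    -- Passing from φ_t to the fixed p makes the constants independent of t.
    rw [TwistedPoly.escapeRate_eq_of_commute v hp0 (hdeg p hr) (hne t ht) hDt
      (φ.commute_toHom t₀ t)] at hH
    obtain ⟨hHpos, hle⟩ := φ.div_le_localHeight hH
      (TwistedPoly.escapeRate_nonneg v hp0 (hdeg p hr) _) hpos
    obtain ⟨he1, -⟩ := ramificationIndex_spec (v := v) hv₀.1
    have hepos : (0 : ℝ) < ramificationIndex v₀ v := mod_cast he1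
    have hbound := TwistedPoly.le_escapeRate hvL.1 hp0 (hdeg p hr)
      (by rw [hp, φ.coeff_zero]; exact hint x v hv t₀)
      ((hB v₀ hv₀).extension (v := v) hv₀.1)
      (one_le_mul_of_one_le_of_one_le (mod_cast he1) hB1) hHpos
    refine le_trans ?_ hle
    rw [← div_div]
    refine div_le_div_of_nonneg_right (le_of_eq_of_le ?_ hbound) (Nat.cast_nonneg _)
    -- With Λ = eB, the bound Λ/(7qDΛ)^k equals C/e^(k−1).
    rw [Real.rpow_sub_one hepos.ne', Real.rpow_natCast]
    push_cast
    rw [← hk, show (7 * (Fintype.card Fq : ℝ) * p.deg * (ramificationIndex v₀ v * B)) =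
      (7 * Fintype.card Fq * p.deg * B) * ramificationIndex v₀ v by ring, mul_pow]
    field_simp
    simp only [mul_pow]
    ring
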